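/- Write points of $\mathbb R^{10}$ as $M=(M_D,M_B,M_P,M_h)\in\mathbb R^3\times\mathbb R^3\times\mathbb R^3\times\mathbb R$, and let $$\mathcal M=\{(D,B,P,h)\in\mathbb R^{10}:\ P=D\wedge B,\ h=\sqrt{1+|D|^2+|B|^2+|P|^2}\}$$ be the Born–Infeld manifold, where $\wedge$ is the vector product of $\mathbb R^3$. Let $\mathcal M^c$ be the convex hull of $\mathcal M$. For an open set $\Omega\subset\mathbb R^3$ and a pair $G=(G^1,G^2)\in (W^{1,\infty}(\Omega;\mathbb R^{3\times3}))^2$ let $\mathcal L(G)\in L^\infty(\Omega;\mathbb R^{2\times 3})$ be given by $\mathcal L(G)_{kj}=\sum_{i=1}^3\partial G^k_{ij}/\partial x_i$ (distributional derivatives). Theorem 4.1. Let $L$ be a compact subset of $\mathrm{Int}(\mathcal M^c)$. Then there is $R>0$, depending only on $L$, such that for every bounded open set $\Omega\subset\mathbb R^3$ and every $F\in L$ there is $V\in L^\infty(\Omega;\mathbb R^{10})$ with the following properties. (i) There is $H=(H^1,H^2)\in (W^{1,\infty}(\Omega;\mathbb R^{3\times3}))^2$, with $H^1$ and $H^2$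 skew-symmetric at every point of $\Omega$, such that $$\begin{pmatrix}V_D^T\\ V_B^T\end{pmatrix}=\begin{pmatrix}F_D^T\\ F_B^T\end{pmatrix}+\mathcal L(H)\quad\text{a.e. in }\Omega,\qquad \|H\|_{L^\infty(\Omega)}<1,$$ and $H=0$ on $\partial\Omega$ (that is, $H$ is continuous on $\overline\Omega$ and vanishes on $\partial\Omega$). Here $\|H\|_{L^\infty(\Omega)}$ is the essential supremum over $\Omega$ of the Euclidean norm $\bigl(\sum_{k,i,j}(H^k_{ij})^2\bigr)^{1/2}$. (ii) $V\in\mathcal M$ a.e. in $\Omega$, and $\|V\|_{L^\infty(\Omega)}\le R$ (with the Euclidean norm on $\mathbb R^{10}$). (iii) $\int_\Omega V\,dx=|\Omega|\,F$, i.e. the average of $V$ over $\Omega$ is $F$ (if $\Omega\neq\emptyset$). -/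

import Mathlib

open MeasureTheory
open scoped ENNReal ContDiff

namespace BornInfeld

/-- Physical space `ℝ³` with its Euclidean norm and Lebesgue measure. -/
abbrev Space : Type := EuclideanSpace ℝ (Fin 3)

/-- The state space `ℝ¹⁰ = ℝ³_D × ℝ³_B × ℝ³_P × ℝ_h` with its Euclidean norm. -/
abbrev State : Type := EuclideanSpace ℝ (Fin 10)

/-- The component `M_D`. -/
noncomputable def State.D (M : State) : Space := !₂[M 0, M 1, M 2]

/-- The component `M_B`. -/
noncomputable def State.B (M : State) : Space := !₂[M 3, M 4, M 5]

/-- The component `M_P`. -/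
noncomputable def State.P (M : State) : Space := !₂[M 6, M 7, M 8]

/-- The component `M_h`. -/
def State.h (M : State) : ℝ := M 9

/-- The vector product on `ℝ³`. -/
noncomputable def wedge (a b : Space) : Space :=
  WithLp.toLp 2 (crossProduct (WithLp.ofLp a) (WithLp.ofLp b))

/-- The Born–Infeld manifold: `P = D ∧ B`, `h = √(1 + |D|² + |B|² + |P|²)`. -/
def manifold : Set State :=
  {M | M.P = wedge M.D M.B ∧ M.h = Real.sqrt (1 + ‖M.D‖ ^ 2 + ‖M.B‖ ^ 2 + ‖M.P‖ ^ 2)}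

/-- The `2 × 3` matrix with rows `M_Dᵀ` and `M_Bᵀ`. -/
noncomputable def State.rows (M : State) : Matrix (Fin 2) (Fin 3) ℝ :=
  Matrix.of ![fun j => M.D j, fun j => M.B j]

/-- `g` is the distributional partial derivative `∂u/∂xᵢ` on the open set `Ω`. -/
def HasWeakPartial (Ω : Set Space) (i : Fin 3) (u g : Space → ℝ) : Prop :=
  LocallyIntegrableOn u Ω ∧ LocallyIntegrableOn g Ω ∧
    ∀ φ : Space → ℝ, ContDiff ℝ ∞ φ → HasCompactSupport φ → tsupport φ ⊆ Ω →
      ∫ x in Ω, u x * fderiv ℝ φ x (EuclideanSpace.single i 1) = -∫ x in Ω, g x * φ x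

/-- The Sobolev space `W^{1,∞}(Ω)`: `u ∈ L^∞(Ω)`, with distributional derivatives in `L^∞(Ω)`. -/
def MemW1Inf (Ω : Set Space) (u : Space → ℝ) : Prop :=
  MemLp u ∞ (volume.restrict Ω) ∧
    ∀ i, ∃ g, MemLp g ∞ (volume.restrict Ω) ∧ HasWeakPartial Ω i u g

/-- Pairs `(G⁰, G¹)` of `3 × 3` matrices. -/
abbrev Tensor : Type := Fin 2 → Matrix (Fin 3) (Fin 3) ℝ

/-- The Euclidean norm of a pair of matrices. -/
noncomputable def Tensor.norm (G : Tensor) : ℝ :=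
  Real.sqrt (∑ k, ∑ i, ∑ j, G k i j ^ 2)

/-- `W` is (a version of) `ℒ(G)` on `Ω`, where `ℒ(G)_{kj} = ∑ᵢ ∂G^k_{ij}/∂xᵢ` in the sense of
distributions. -/
def IsCalL (Ω : Set Space) (G : Space → Tensor) (W : Space → Matrix (Fin 2) (Fin 3) ℝ) : Prop :=
  ∃ dG : Fin 3 → Space → Tensor,
    (∀ l k i j, HasWeakPartial Ω l (fun x => G x k i j) (fun x => dG l x k i j)) ∧
      ∀ᵐ x ∂volume.restrict Ω, ∀ k j, W x k j = ∑ i, dG i x k i j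

end BornInfeld

open BornInfeld

/-! The manifold is the graph of a continuous map q, giving (P, h), over the pairs z = (D, B), and
only z carries a differential constraint. A field `z + 𝓛 (DH)`, with H Lipschitz and zero off Ω, has
mean z and is completed by q to a field on the manifold; the only question is which averages of q
occur. For a fixed bound R on the field, let A(z) be the set of these averages on the unit ball
(`attainable`).

Packing Ω with small rescaled copies of the ball realises the same averages on every open set of
finite measure, by arbitrarily small potentials (`exists_isPotentialFor_of_mem_attainable`). Two
vectors of ℝ³ have a common normal, so every difference z₁ - z₂ is the amplitude of a plane wave
(`exists_divSkew_smulRight_eq`). Laminating z₁ with z₂ and then refining inside the layers puts t y₁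
+ (1 - t) y₂ within any δ > 0 of A(t z₁ + (1 - t) z₂) whenever yᵢ ∈ A(zᵢ)
(`exists_mem_attainable_near`). Hence the pairs (z, y) with ‖z‖ < R and y in the closure of A(z)
form a convex set; it contains the graph over the ball of radius R, so also its convex hull.

Convexity, not iteration, removes the remaining error: A(z) is itself convex (`convex_attainable`),
and a convex set in finite dimension contains the interior of its closure. An interior point of the
hull is therefore attained exactly. Compactness of L provides a single R
(`exists_subset_interior_convexHull_graph`). -/

open Metric Set Filter
open scoped NNReal Topology

/-! ### Lipschitz functions: derivatives on level sets, zero mean, gluing -/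

section LipschitzDerivative

variable {E T : Type*} [NormedAddCommGroup E] [NormedSpace ℝ E] [FiniteDimensional ℝ E]
  [MeasurableSpace E] [BorelSpace E] {μ : Measure E} [μ.IsAddHaarMeasure]
  [NormedAddCommGroup T] [NormedSpace ℝ T]

/-- The derivative of a Lipschitz function vanishes almost everywhere on its zero set. -/
theorem LipschitzWith.ae_fderiv_eq_zero_of_eq_zero {C : ℝ≥0} {f : E → T}
    (hf : LipschitzWith C f) : ∀ᵐ x ∂μ, f x = 0 → fderiv ℝ f x = 0 := by
  -- Rademacher is applied to the scalar function ‖f‖, so T may have any dimension. A zero of f is a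
  -- minimum of ‖f‖, where its derivative must vanish; then f itself is o(‖y - x‖).
  have hn : LipschitzWith C fun x => ‖f x‖ := by
    simpa [Function.comp_def] using lipschitzWith_one_norm.comp hf
  filter_upwards [hn.ae_differentiableAt (μ := μ)] with x hx h0
  have hmin : IsLocalMin (fun x => ‖f x‖) x := by
    filter_upwards with y
    simp [h0]
  have hd : HasFDerivAt (fun x => ‖f x‖) (0 : E →L[ℝ] ℝ) x := by
    simpa [hmin.fderiv_eq_zero] using hx.hasFDerivAt
  have : HasFDerivAt f (0 : E →L[ℝ] T) x := by
    rw [hasFDerivAt_iff_isLittleO] at hd ⊢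
    simp only [h0, norm_zero, sub_zero, zero_apply] at hd ⊢
    exact Asymptotics.isLittleO_norm_left.1 hd
  exact this.fderiv

/-- Almost everywhere, the derivative of a minimum of two Lipschitz functions is the derivative
of the smaller one. -/
theorem LipschitzWith.ae_fderiv_min_eq {C D : ℝ≥0} {u v : E → ℝ} (hu : LipschitzWith C u)
    (hv : LipschitzWith D v) : ∀ᵐ x ∂μ, u x ≤ v x →
      fderiv ℝ (fun x => min (u x) (v x)) x = fderiv ℝ u x := by
  have hm := hu.min hv
  filter_upwards [(hu.sub hm).ae_fderiv_eq_zero_of_eq_zero (μ := μ),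
    hu.ae_differentiableAt (μ := μ), hm.ae_differentiableAt (μ := μ)] with x h hxu hxm hle
  have h1 := h (by simp [hle])
  rw [fderiv_fun_sub hxu hxm, sub_eq_zero] at h1
  exact h1.symm

/-- The derivative of a compactly supported Lipschitz function has zero mean. -/
theorem LipschitzWith.integral_fderiv_eq_zero_of_real {C : ℝ≥0} {u : E → ℝ} (hu : LipschitzWith C u)
    (hc : HasCompactSupport u) : ∫ x, fderiv ℝ u x ∂μ = 0 := by
  have key (v : E) : ∫ x, fderiv ℝ u x v ∂μ = 0 := by
    have h := LipschitzWith.integral_lineDeriv_mul_eq (μ := μ)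
      (LipschitzWith.const (1 : ℝ) : LipschitzWith 0 fun _ : E => (1 : ℝ)) hu hc (-v)
    have h0 (x : E) : lineDeriv ℝ (fun _ : E => (1 : ℝ)) x (-v) = 0 := by
      simp [lineDeriv]
    simp only [h0, zero_mul, integral_zero, neg_neg, mul_one] at h
    rw [h]
    refine integral_congr_ae ?_
    filter_upwards [hu.ae_differentiableAt (μ := μ)] with x hx
    exact hx.lineDeriv_eq_fderiv.symm
  by_cases hi : Integrable (fderiv ℝ u) μ
  · ext v
    rw [ContinuousLinearMap.integral_apply hi, key]
    simp
  · exact integral_undef hi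

/-- Uniformly Lipschitz functions with disjoint supports glue to a Lipschitz function. -/
theorem exists_lipschitzWith_glue {ι X T : Type*} [PseudoMetricSpace X]
    [NormedAddCommGroup T] {S : ι → Set X}
    (hS : Pairwise (Function.onFun Disjoint S)) {f : ι → X → T} {C : ℝ≥0} (hf : ∀ i, LipschitzWith C (f i))
    (h0 : ∀ i, ∀ x ∉ S i, f i x = 0) :
    ∃ F : X → T, LipschitzWith (2 * C) F ∧ (∀ i, EqOn F (f i) (S i)) ∧
      ∀ x, (∀ i, x ∉ S i) → F x = 0 := by
  classical
  let F : X → T := fun x => if h : ∃ i, x ∈ S i then f h.choose x else 0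
  have hF (i) : EqOn F (f i) (S i) := by
    intro x hx
    have h : ∃ i, x ∈ S i := ⟨i, hx⟩
    have : h.choose = i := by
      by_contra hne
      exact (hS hne).le_bot ⟨h.choose_spec, hx⟩
    simp only [F, dif_pos h, this]
  have hF0 (x) (hx : ∀ i, x ∉ S i) : F x = 0 := by
    simp only [F]
    rw [dif_neg (by simpa using hx)]
  refine ⟨F, LipschitzWith.of_dist_le_mul fun x y => ?_, hF, hF0⟩
  -- Comparison with a point where `f i` vanishes. Two points in different pieces each cost one such
  -- bound, hence the factor 2.
  have hb (i) (x y : X) (hy : y ∉ S i) : ‖f i x‖ ≤ C * dist x y := by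
    have := (hf i).dist_le_mul x y
    rwa [h0 i y hy, dist_zero_right] at this
  have hd : 0 ≤ C * dist x y := by positivity
  push_cast
  by_cases hx : ∃ i, x ∈ S i <;> by_cases hy : ∃ j, y ∈ S j
  · obtain ⟨i, hi⟩ := hx
    obtain ⟨j, hj⟩ := hy
    rw [hF i hi, hF j hj]
    by_cases hij : i = j
    · subst hij
      linarith [(hf i).dist_le_mul x y]
    · have h1 := hb i x y fun h => (hS hij).le_bot ⟨h, hj⟩
      have h2 := hb j y x fun h => (hS hij).le_bot ⟨hi, h⟩
      rw [dist_comm y x] at h2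
      linarith [dist_le_norm_add_norm (f i x) (f j y)]
  · obtain ⟨i, hi⟩ := hx
    rw [hF i hi, hF0 y (by simpa using hy), dist_zero_right]
    linarith [hb i x y fun h => hy ⟨i, h⟩]
  · obtain ⟨j, hj⟩ := hy
    have := hb j y x fun h => hx ⟨j, h⟩
    rw [dist_comm y x] at this
    rw [hF j hj, hF0 x (by simpa using hx), dist_zero_left]
    linarith
  · rw [hF0 x (by simpa using hx), hF0 y (by simpa using hy), dist_self]
    linarith

/-! ### The sawtooth profile -/

/-- The sawtooth of amplitude at most one with slopes `1 - t` and `-t`. -/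
noncomputable def sawtooth (t s : ℝ) : ℝ := min ((1 - t) * Int.fract s) (t * (1 - Int.fract s))

theorem sawtooth_nonneg {t : ℝ} (h0 : 0 ≤ t) (h1 : t ≤ 1) (s : ℝ) : 0 ≤ sawtooth t s :=
  le_min (mul_nonneg (by linarith) (Int.fract_nonneg s))
    (mul_nonneg h0 (by linarith [Int.fract_lt_one s]))

theorem sawtooth_le_one {t : ℝ} (h0 : 0 ≤ t) (h1 : t ≤ 1) (s : ℝ) : sawtooth t s ≤ 1 := by
  refine (min_le_right _ _).trans ?_
  nlinarith [Int.fract_nonneg s]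

/-- Together with `sawtooth_eq`, this presents the sawtooth as a minimum over n of 1-Lipschitz
tents, which gives the Lipschitz bound without examining the jumps of the fractional part. -/
theorem sawtooth_le {t : ℝ} (h0 : 0 ≤ t) (h1 : t ≤ 1) (s : ℝ) (n : ℤ) :
    sawtooth t s ≤ max ((1 - t) * (s - n)) (-t * (s - n)) := by
  have hs := Int.floor_add_fract s
  have hf0 := Int.fract_nonneg s
  have hf1 := Int.fract_lt_one s
  rcases le_or_gt n ⌊s⌋ with h | h
  · refine (min_le_left _ _).trans (le_max_of_le_left ?_)
    have : (n : ℝ) ≤ ⌊s⌋ := by exact_mod_cast h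
    exact mul_le_mul_of_nonneg_left (by linarith) (by linarith)
  · refine (min_le_right _ _).trans (le_max_of_le_right ?_)
    have : (⌊s⌋ : ℝ) + 1 ≤ n := by exact_mod_cast h
    nlinarith

theorem sawtooth_eq {t : ℝ} (s : ℝ) :
    ∃ n : ℤ, sawtooth t s = max ((1 - t) * (s - n)) (-t * (s - n)) := by
  have hs := Int.floor_add_fract s
  have hf0 := Int.fract_nonneg s
  have hf1 := Int.fract_lt_one s
  rcases le_total (Int.fract s) t with h | h
  · refine ⟨⌊s⌋, ?_⟩
    rw [sawtooth, min_eq_left (by nlinarith), max_eq_left (by nlinarith)]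
    congr 1
  · refine ⟨⌊s⌋ + 1, ?_⟩
    rw [sawtooth, min_eq_right (by nlinarith), max_eq_right (by push_cast; nlinarith)]
    push_cast
    linear_combination (-t) * hs

theorem lipschitzWith_sawtooth {t : ℝ} (h0 : 0 ≤ t) (h1 : t ≤ 1) :
    LipschitzWith 1 (sawtooth t) := by
  have key (a b : ℝ) : sawtooth t a ≤ sawtooth t b + |a - b| := by
    obtain ⟨n, hn⟩ := sawtooth_eq (t := t) b
    refine (sawtooth_le h0 h1 a n).trans ?_
    rw [hn]
    have h2 : (1 - t) * (a - b) ≤ |a - b| := by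
      cases abs_cases (a - b) <;> nlinarith
    have h3 : -t * (a - b) ≤ |a - b| := by
      cases abs_cases (a - b) <;> nlinarith
    refine max_le ?_ ?_
    · linarith [le_max_left ((1 - t) * (b - n)) (-t * (b - n))]
    · linarith [le_max_right ((1 - t) * (b - n)) (-t * (b - n))]
  refine LipschitzWith.of_dist_le_mul fun a b => ?_
  rw [Real.dist_eq, Real.dist_eq, NNReal.coe_one, one_mul, abs_le]
  constructor
  · have := key b a
    rw [abs_sub_comm] at this
    linarith
  · linarith [key a b]

theorem sawtooth_hasDerivAt_left {t : ℝ} (h1 : t ≤ 1) {s : ℝ} {n : ℤ} (hn : ↑n < s)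
    (hs : s < n + t) : HasDerivAt (sawtooth t) (1 - t) s := by
  have : sawtooth t =ᶠ[𝓝 s] fun r => (1 - t) * (r - n) := by
    filter_upwards [Ioo_mem_nhds hn hs] with r hr
    have hfl : ⌊r⌋ = n := Int.floor_eq_iff.2 ⟨hr.1.le, by linarith [hr.2]⟩
    have hf : Int.fract r = r - n := by rw [Int.fract, hfl]
    rw [sawtooth, hf, min_eq_left]
    nlinarith [hr.1, hr.2]
  refine HasDerivAt.congr_of_eventuallyEq ?_ this
  simpa using ((hasDerivAt_id s).sub_const (n : ℝ)).const_mul (1 - t)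

theorem sawtooth_hasDerivAt_right {t : ℝ} (h0 : 0 ≤ t) {s : ℝ} {n : ℤ} (hn : n + t < s)
    (hs : s < n + 1) : HasDerivAt (sawtooth t) (-t) s := by
  have : sawtooth t =ᶠ[𝓝 s] fun r => t * (1 - (r - n)) := by
    filter_upwards [Ioo_mem_nhds hn hs] with r hr
    have hfl : ⌊r⌋ = n := Int.floor_eq_iff.2 ⟨by linarith [hr.1], hr.2⟩
    have hf : Int.fract r = r - n := by rw [Int.fract, hfl]
    rw [sawtooth, hf, min_eq_right]
    nlinarith [hr.1, hr.2]
  refine HasDerivAt.congr_of_eventuallyEq ?_ this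
  simpa using (((hasDerivAt_id s).sub_const (n : ℝ)).const_sub 1).const_mul t

end LipschitzDerivative

/-! ### Plane waves cut off at the boundary of the ball -/

section PlaneWave

variable {E : Type*} [NormedAddCommGroup E] [NormedSpace ℝ E] [FiniteDimensional ℝ E]
  [MeasurableSpace E] [BorelSpace E] (μ : Measure E) [μ.IsAddHaarMeasure]

/-- The level sets of a nonzero linear form are negligible. -/
theorem ae_apply_ne_of_ne_zero {ξ : E →L[ℝ] ℝ} (hξ : ξ ≠ 0) (c : ℝ) : ∀ᵐ x ∂μ, ξ x ≠ c := by
  rw [ae_iff]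
  simp only [not_not]
  by_cases hx : ∃ x₀, ξ x₀ = c
  · obtain ⟨x₀, h₀⟩ := hx
    have hs : {x | ξ x = c} = (AffineSubspace.mk' x₀ ξ.ker : Set E) := by
      ext x
      simp [AffineSubspace.mem_mk', sub_eq_zero, h₀]
    rw [hs]
    refine Measure.addHaar_affineSubspace μ _ fun h => hξ ?_
    have h2 := congrArg AffineSubspace.direction h
    rw [AffineSubspace.direction_mk', AffineSubspace.direction_top] at h2
    ext v
    have : v ∈ ξ.ker := by rw [h2]; trivial
    simpa using this
  · have : {x | ξ x = c} = ∅ := by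
      ext x
      simpa using fun h => hx ⟨x, h⟩
    rw [this, measure_empty]

theorem measureReal_ball_of_pos (x : E) {r : ℝ} (hr : 0 < r) :
    μ.real (ball x r) = r ^ Module.finrank ℝ E * μ.real (ball (0 : E) 1) := by
  rw [measureReal_def, Measure.addHaar_ball_of_pos μ x hr, ENNReal.toReal_mul,
    ENNReal.toReal_ofReal (by positivity), measureReal_def]

theorem exists_ball_diff_ball_lt {η : ℝ} (hη : 0 < η) :
    ∃ r : ℝ, 0 < r ∧ r < 1 ∧ μ.real (ball (0 : E) 1 \ ball 0 r) < η := by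
  set d := Module.finrank ℝ E
  set m := μ.real (ball (0 : E) 1)
  have hc : Continuous fun r : ℝ => m - r ^ d * m := by fun_prop
  have ht : Tendsto (fun r : ℝ => m - r ^ d * m) (𝓝[<] 1) (𝓝 0) := by
    have := hc.tendsto 1
    simp only [one_pow, one_mul, sub_self] at this
    exact this.mono_left nhdsWithin_le_nhds
  obtain ⟨r, hr1, hr2⟩ := ((ht.eventually (gt_mem_nhds hη)).and
    (Ioo_mem_nhdsLT (zero_lt_one' ℝ))).exists
  refine ⟨r, hr2.1, hr2.2, ?_⟩
  rw [measureReal_sdiff (ball_subset_ball hr2.2.le) measurableSet_ball,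
    measureReal_ball_of_pos μ 0 hr2.1]
  exact hr1

/-- A plane wave with gradients `(1 - t) ξ` and `-t ξ`, cut off at the boundary of the unit
ball. -/
theorem exists_planeWave {ξ : E →L[ℝ] ℝ} (hξ : ξ ≠ 0) {t : ℝ} (ht0 : 0 < t) (ht1 : t < 1)
    {κ η : ℝ} (hκ : 0 < κ) (hη : 0 < η) :
    ∃ (u : E → ℝ) (Ω₁ Ω₂ : Set E), (∃ C, LipschitzWith C u) ∧ (∀ x, ‖u x‖ ≤ κ) ∧
      (∀ x ∉ ball (0 : E) 1, u x = 0) ∧ IsOpen Ω₁ ∧ IsOpen Ω₂ ∧ Disjoint Ω₁ Ω₂ ∧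
      Ω₁ ⊆ ball 0 1 ∧ Ω₂ ⊆ ball 0 1 ∧ (∀ x ∈ Ω₁, fderiv ℝ u x = (1 - t) • ξ) ∧
      (∀ x ∈ Ω₂, fderiv ℝ u x = (-t) • ξ) ∧
      (∀ᵐ x ∂μ, ‖fderiv ℝ u x‖ ≤ κ ∨ fderiv ℝ u x = (1 - t) • ξ ∨ fderiv ℝ u x = (-t) • ξ) ∧
      μ.real (ball 0 1 \ (Ω₁ ∪ Ω₂)) < η := by
  obtain ⟨r, hr0, hr1, hr⟩ := exists_ball_diff_ball_lt μ hη
  -- This frequency keeps the sawtooth, of height at most `N⁻¹`, below the cone `κ (1 - ‖x‖)` on the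
  -- ball of radius r.
  obtain ⟨N, hN0, hN⟩ : ∃ N : ℝ, 0 < N ∧ N⁻¹ ≤ κ * (1 - r) := by
    refine ⟨(κ * (1 - r))⁻¹, ?_, by simp⟩
    have : 0 < 1 - r := by linarith
    positivity
  let a : E → ℝ := fun x => N⁻¹ * sawtooth t (N * ξ x)
  let b : E → ℝ := fun x => κ * max (1 - ‖x‖) 0
  have ha : LipschitzWith ‖ξ‖₊ a := by
    have h := (lipschitzWith_sawtooth ht0.le ht1.le).comp (N • ξ).lipschitz
    refine LipschitzWith.of_dist_le_mul fun x y => ?_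
    have h2 := h.dist_le_mul x y
    simp only [Function.comp, one_mul, nnnorm_smul, NNReal.coe_mul, coe_nnnorm,
      Real.norm_eq_abs, abs_of_pos hN0, FunLike.coe_smul, Pi.smul_apply,
      smul_eq_mul, Real.dist_eq] at h2 ⊢
    simp only [a]
    rw [← mul_sub, abs_mul, abs_of_pos (inv_pos.2 hN0), inv_mul_le_iff₀ hN0]
    linarith
  have hb : LipschitzWith κ.toNNReal b := by
    refine LipschitzWith.of_dist_le_mul fun x y => ?_
    simp only [b, Real.dist_eq, Real.coe_toNNReal _ hκ.le]
    rw [← mul_sub, abs_mul, abs_of_pos hκ]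
    refine mul_le_mul_of_nonneg_left ?_ hκ.le
    refine (abs_max_sub_max_le_abs _ _ _).trans ?_
    rw [dist_eq_norm, sub_sub_sub_cancel_left, abs_sub_comm]
    exact abs_norm_sub_norm_le x y
  have ha0 (x) : 0 ≤ a x := mul_nonneg (inv_pos.2 hN0).le (sawtooth_nonneg ht0.le ht1.le _)
  have ha1 (x) : a x ≤ N⁻¹ := by
    have := sawtooth_le_one ht0.le ht1.le (N * ξ x)
    have := mul_le_mul_of_nonneg_left this (inv_pos.2 hN0).le
    simpa [a] using this
  have hb0 (x) : 0 ≤ b x := mul_nonneg hκ.le (le_max_right _ _)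
  -- The cutoff is a minimum rather than a product: almost everywhere the gradient is either that of
  -- the wave, exactly, or that of the cone, of norm at most κ. No uncontrolled gradient arises in
  -- the transition layer.
  let u : E → ℝ := fun x => min (a x) (b x)
  have hu : LipschitzWith (max ‖ξ‖₊ κ.toNNReal) u := ha.min hb
  have hin (x) (hx : x ∈ ball (0 : E) r) : u x = a x := by
    refine min_eq_left ((ha1 x).trans (hN.trans ?_))
    rw [mem_ball_zero_iff] at hx
    exact mul_le_mul_of_nonneg_left (le_max_of_le_left (by linarith)) hκ.le
  have hcomp {s : ℝ} {x : E} (h : HasDerivAt (sawtooth t) s (N * ξ x)) :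
      HasFDerivAt a (s • ξ) x := by
    have h1 : HasFDerivAt (fun x => N * ξ x) (N • ξ) x := (N • ξ).hasFDerivAt
    have h2 := (h.comp_hasFDerivAt x h1).const_mul N⁻¹
    rwa [smul_comm s N, inv_smul_smul₀ hN0.ne'] at h2
  have hopen (p q : ℝ) : IsOpen {x : E | ∃ n : ℤ, n + p < N * ξ x ∧ N * ξ x < n + q} := by
    have : {x : E | ∃ n : ℤ, n + p < N * ξ x ∧ N * ξ x < n + q} =
        ⋃ n : ℤ, (fun x => N * ξ x) ⁻¹' Ioo (n + p) (n + q) := by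
      ext x
      simp
    rw [this]
    exact isOpen_iUnion fun n => isOpen_Ioo.preimage (by fun_prop)
  have hloc {x : E} (hx : x ∈ ball (0 : E) r) : u =ᶠ[𝓝 x] a := by
    filter_upwards [isOpen_ball.mem_nhds hx] with y hy using hin y hy
  have hae : ∀ᵐ x ∂μ, (∃ n : ℤ, n + 0 < N * ξ x ∧ N * ξ x < n + t) ∨
      (∃ n : ℤ, n + t < N * ξ x ∧ N * ξ x < n + 1) := by
    have h1 : ∀ᵐ x ∂μ, ∀ n : ℤ, ξ x ≠ N⁻¹ * n :=
      ae_all_iff.2 fun n => ae_apply_ne_of_ne_zero μ hξ _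
    have h2 : ∀ᵐ x ∂μ, ∀ n : ℤ, ξ x ≠ N⁻¹ * (n + t) :=
      ae_all_iff.2 fun n => ae_apply_ne_of_ne_zero μ hξ _
    filter_upwards [h1, h2] with x h1 h2
    have h3 := Int.floor_le (N * ξ x)
    have h4 := Int.lt_floor_add_one (N * ξ x)
    have h5 : (⌊N * ξ x⌋ : ℝ) ≠ N * ξ x := fun h => h1 ⌊N * ξ x⌋ (by rw [h]; field_simp)
    have h6 : (⌊N * ξ x⌋ : ℝ) + t ≠ N * ξ x := fun h => h2 ⌊N * ξ x⌋ (by rw [h]; field_simp)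
    rcases lt_or_gt_of_ne h6 with h | h
    · exact Or.inr ⟨_, h, h4⟩
    · exact Or.inl ⟨_, by rw [add_zero]; exact lt_of_le_of_ne h3 h5, h⟩
  refine ⟨u, ball 0 r ∩ {x | ∃ n : ℤ, n + 0 < N * ξ x ∧ N * ξ x < n + t},
    ball 0 r ∩ {x | ∃ n : ℤ, n + t < N * ξ x ∧ N * ξ x < n + 1}, ⟨_, hu⟩, fun x => ?_,
    fun x hx => ?_, isOpen_ball.inter (hopen 0 t), isOpen_ball.inter (hopen t 1), ?_,
    inter_subset_left.trans (ball_subset_ball hr1.le),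
    inter_subset_left.trans (ball_subset_ball hr1.le), ?_, ?_, ?_, ?_⟩
  · rw [Real.norm_eq_abs, abs_of_nonneg (le_min (ha0 x) (hb0 x))]
    refine (min_le_left _ _).trans ((ha1 x).trans (hN.trans ?_))
    nlinarith
  · rw [mem_ball_zero_iff, not_lt] at hx
    have : b x = 0 := by simp [b, max_eq_right (sub_nonpos.2 hx)]
    simp only [u, this]
    exact min_eq_right (ha0 x)
  · rw [Set.disjoint_left]
    rintro x ⟨-, n, hn1, hn2⟩ ⟨-, k, hk1, hk2⟩
    have h1 : n < k + 1 := by exact_mod_cast (by linarith : (n : ℝ) < k + 1)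
    have h2 : k < n := by exact_mod_cast (by linarith : (k : ℝ) < n)
    omega
  · rintro x ⟨hx, n, h1, h2⟩
    rw [(hloc hx).fderiv_eq]
    exact (hcomp (sawtooth_hasDerivAt_left ht1.le (by linarith) h2)).fderiv
  · rintro x ⟨hx, n, h1, h2⟩
    rw [(hloc hx).fderiv_eq]
    exact (hcomp (sawtooth_hasDerivAt_right ht0.le h1 h2)).fderiv
  · filter_upwards [hae, ha.ae_fderiv_min_eq (μ := μ) hb, hb.ae_fderiv_min_eq (μ := μ) ha]
      with x hx hab hba
    rcases le_total (a x) (b x) with h | h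
    · refine Or.inr ?_
      change fderiv ℝ (fun x => min (a x) (b x)) x = _ ∨ fderiv ℝ (fun x => min (a x) (b x)) x = _
      rw [hab h]
      rcases hx with ⟨n, h1, h2⟩ | ⟨n, h1, h2⟩
      · exact Or.inl (hcomp (sawtooth_hasDerivAt_left ht1.le (by linarith) h2)).fderiv
      · exact Or.inr (hcomp (sawtooth_hasDerivAt_right ht0.le h1 h2)).fderiv
    · refine Or.inl ?_
      have h2 := hba h
      simp only [min_comm (b _)] at h2
      change ‖fderiv ℝ (fun x => min (a x) (b x)) x‖ ≤ κ
      rw [h2]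
      simpa [hκ.le] using norm_fderiv_le_of_lipschitz ℝ hb (x₀ := x)
  · refine lt_of_le_of_lt ?_ hr
    refine ENNReal.toReal_mono
      (measure_ne_top_of_subset sdiff_subset measure_ball_lt_top.ne) (measure_mono_ae ?_)
    filter_upwards [hae] with x hx hxm
    refine ⟨hxm.1, fun hxr => hxm.2 ?_⟩
    exact hx.imp (fun h => ⟨hxr, h⟩) fun h => ⟨hxr, h⟩

end PlaneWave

/-! ### Averages of q along fields, and their transfer to open sets -/

section Attains

variable {E T Z Y : Type*} [NormedAddCommGroup E] [NormedSpace ℝ E] [FiniteDimensional ℝ E]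
  [MeasurableSpace E] [BorelSpace E]
  [NormedAddCommGroup T] [NormedSpace ℝ T] [FiniteDimensional ℝ T]
  [NormedAddCommGroup Z] [NormedSpace ℝ Z]
  [NormedAddCommGroup Y]

/-- `H` is a Lipschitz potential of size at most `ε` vanishing outside `Ω` such that the field
`z + 𝓛 (DH)` takes its values in the ball of radius `R` and the average of `q` along this field
is `y`. -/
structure IsPotentialFor [NormedSpace ℝ Y] (μ : Measure E) (𝓛 : (E →L[ℝ] T) →L[ℝ] Z) (q : Z → Y) (R : ℝ)
    (Ω : Set E) (ε : ℝ) (z : Z) (y : Y) (H : E → T) : Prop where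
  lipschitz : ∃ C, LipschitzWith C H
  eq_zero : ∀ x ∉ Ω, H x = 0
  norm_le : ∀ x, ‖H x‖ ≤ ε
  norm_lt : ∀ᵐ x ∂μ, x ∈ Ω → ‖z + 𝓛 (fderiv ℝ H x)‖ < R
  integral_eq : ∫ x in Ω, q (z + 𝓛 (fderiv ℝ H x)) ∂μ = μ.real Ω • y

/-- The averages of `q` along fields `z + 𝓛 (DH)` on the unit ball. -/
def attainable [NormedSpace ℝ Y] (μ : Measure E) (𝓛 : (E →L[ℝ] T) →L[ℝ] Z) (q : Z → Y) (R : ℝ) (z : Z) : Set Y :=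
  {y | ∃ H, IsPotentialFor μ 𝓛 q R (ball 0 1) 1 z y H}

variable {μ : Measure E} {𝓛 : (E →L[ℝ] T) →L[ℝ] Z} {q : Z → Y} {R : ℝ}

theorem aestronglyMeasurable_comp_fderiv (hq : Continuous q) (z : Z) (H : E → T) :
    AEStronglyMeasurable (fun x => q (z + 𝓛 (fderiv ℝ H x))) μ := by
  have : ProperSpace (E →L[ℝ] T) := FiniteDimensional.proper ℝ _
  borelize (E →L[ℝ] T)
  have h : StronglyMeasurable (fderiv ℝ H) := (measurable_fderiv ℝ H).stronglyMeasurable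
  have hc : Continuous fun A : E →L[ℝ] T => q (z + 𝓛 A) := by fun_prop
  exact (hc.comp_stronglyMeasurable h).aestronglyMeasurable

theorem exists_norm_le_of_norm_lt [FiniteDimensional ℝ Z] (hq : Continuous q) (R : ℝ) :
    ∃ C : ℝ, 0 ≤ C ∧ ∀ ζ, ‖ζ‖ < R → ‖q ζ‖ ≤ C := by
  have : ProperSpace Z := FiniteDimensional.proper ℝ _
  obtain ⟨C, hC⟩ := (isCompact_closedBall (0 : Z) R).exists_bound_of_continuousOn hq.continuousOn
  refine ⟨max C 0, le_max_right _ _, fun ζ hζ => (hC ζ ?_).trans (le_max_left _ _)⟩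
  simpa using hζ.le

theorem integrableOn_comp_fderiv [FiniteDimensional ℝ Z] (hq : Continuous q) {Ω : Set E} (hΩ : MeasurableSet Ω)
    (hμ : μ Ω ≠ ⊤) {z : Z} {H : E → T}
    (h : ∀ᵐ x ∂μ, x ∈ Ω → ‖z + 𝓛 (fderiv ℝ H x)‖ < R) :
    IntegrableOn (fun x => q (z + 𝓛 (fderiv ℝ H x))) Ω μ := by
  obtain ⟨C, -, hC⟩ := exists_norm_le_of_norm_lt hq R
  refine IntegrableOn.of_bound hμ.lt_top (aestronglyMeasurable_comp_fderiv hq z H) C ?_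
  rw [ae_restrict_iff' hΩ]
  filter_upwards [h] with x hx hxΩ using hC _ (hx hxΩ)

variable [μ.IsAddHaarMeasure] [NormedSpace ℝ Y]

/-- Potentials on two disjoint open subsets can be added to a given one. -/
theorem exists_patch {Ω Ω₁ Ω₂ : Set E} (h1o : IsOpen Ω₁) (h2o : IsOpen Ω₂)
    (hd : Disjoint Ω₁ Ω₂) (h1 : Ω₁ ⊆ Ω) (h2 : Ω₂ ⊆ Ω) {ε ε₀ : ℝ}
    {z z₁ z₂ : Z} {y₁ y₂ : Y} {H₀ H₁ H₂ : E → T} (hL : ∃ C, LipschitzWith C H₀)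
    (h0 : ∀ x ∉ Ω, H₀ x = 0) (hb : ∀ x, ‖H₀ x‖ ≤ ε₀)
    (hz1 : ∀ᵐ x ∂μ, x ∈ Ω₁ → z + 𝓛 (fderiv ℝ H₀ x) = z₁)
    (hz2 : ∀ᵐ x ∂μ, x ∈ Ω₂ → z + 𝓛 (fderiv ℝ H₀ x) = z₂)
    (H1 : IsPotentialFor μ 𝓛 q R Ω₁ ε z₁ y₁ H₁) (H2 : IsPotentialFor μ 𝓛 q R Ω₂ ε z₂ y₂ H₂) :
    ∃ H : E → T, (∃ C, LipschitzWith C H) ∧ (∀ x ∉ Ω, H x = 0) ∧ (∀ x, ‖H x‖ ≤ ε₀ + ε) ∧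
      (∀ᵐ x ∂μ, x ∈ Ω₁ → ‖z + 𝓛 (fderiv ℝ H x)‖ < R) ∧
      (∀ᵐ x ∂μ, x ∈ Ω₂ → ‖z + 𝓛 (fderiv ℝ H x)‖ < R) ∧
      (∀ᵐ x ∂μ, x ∉ Ω₁ → x ∉ Ω₂ → fderiv ℝ H x = fderiv ℝ H₀ x) ∧
      (∫ x in Ω₁, q (z + 𝓛 (fderiv ℝ H x)) ∂μ = μ.real Ω₁ • y₁) ∧
      (∫ x in Ω₂, q (z + 𝓛 (fderiv ℝ H x)) ∂μ = μ.real Ω₂ • y₂) := by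
  obtain ⟨C₀, hL0⟩ := hL
  obtain ⟨C₁, hL1⟩ := H1.lipschitz
  obtain ⟨C₂, hL2⟩ := H2.lipschitz
  have hadd : ∀ᵐ x ∂μ, fderiv ℝ (fun x => H₀ x + (H₁ x + H₂ x)) x =
      fderiv ℝ H₀ x + (fderiv ℝ H₁ x + fderiv ℝ H₂ x) := by
    filter_upwards [hL0.ae_differentiableAt (μ := μ), hL1.ae_differentiableAt (μ := μ),
      hL2.ae_differentiableAt (μ := μ)] with x hx0 hx1 hx2
    rw [fderiv_fun_add hx0 (hx1.fun_add hx2), fderiv_fun_add hx1 hx2]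
  -- The boundary of a piece may have positive measure; the derivative vanishes almost everywhere on
  -- the whole zero set, boundary included.
  have hz1' : ∀ᵐ x ∂μ, x ∉ Ω₁ → fderiv ℝ H₁ x = 0 := by
    filter_upwards [hL1.ae_fderiv_eq_zero_of_eq_zero (μ := μ)] with x hx hx'
    exact hx (H1.eq_zero x hx')
  have hz2' : ∀ᵐ x ∂μ, x ∉ Ω₂ → fderiv ℝ H₂ x = 0 := by
    filter_upwards [hL2.ae_fderiv_eq_zero_of_eq_zero (μ := μ)] with x hx hx'
    exact hx (H2.eq_zero x hx')
  have e1 : ∀ᵐ x ∂μ, x ∈ Ω₁ → z + 𝓛 (fderiv ℝ (fun x => H₀ x + (H₁ x + H₂ x)) x) =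
      z₁ + 𝓛 (fderiv ℝ H₁ x) := by
    filter_upwards [hadd, hz2', hz1] with x hx hx2 hz1 hm
    rw [hx, hx2 (Set.disjoint_left.1 hd hm), add_zero, map_add, ← add_assoc, hz1 hm]
  have e2 : ∀ᵐ x ∂μ, x ∈ Ω₂ → z + 𝓛 (fderiv ℝ (fun x => H₀ x + (H₁ x + H₂ x)) x) =
      z₂ + 𝓛 (fderiv ℝ H₂ x) := by
    filter_upwards [hadd, hz1', hz2] with x hx hx1 hz2 hm
    rw [hx, hx1 (Set.disjoint_right.1 hd hm), zero_add, map_add, ← add_assoc, hz2 hm]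
  refine ⟨fun x => H₀ x + (H₁ x + H₂ x), ⟨_, hL0.add (hL1.add hL2)⟩, fun x hx => ?_, fun x => ?_,
    ?_, ?_, ?_, ?_, ?_⟩
  · simp [h0 x hx, H1.eq_zero x fun h => hx (h1 h), H2.eq_zero x fun h => hx (h2 h)]
  · refine (norm_add_le _ _).trans (add_le_add (hb x) ?_)
    by_cases hx : x ∈ Ω₁
    · rw [H2.eq_zero x (Set.disjoint_left.1 hd hx), add_zero]
      exact H1.norm_le x
    · rw [H1.eq_zero x hx, zero_add]
      exact H2.norm_le x
  · filter_upwards [e1, H1.norm_lt] with x hx hx' hm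
    rw [hx hm]
    exact hx' hm
  · filter_upwards [e2, H2.norm_lt] with x hx hx' hm
    rw [hx hm]
    exact hx' hm
  · filter_upwards [hadd, hz1', hz2'] with x hx hx1 hx2 hm1 hm2
    rw [hx, hx1 hm1, hx2 hm2, add_zero, add_zero]
  · rw [← H1.integral_eq]
    refine setIntegral_congr_ae h1o.measurableSet ?_
    filter_upwards [e1] with x hx hm
    rw [hx hm]
  · rw [← H2.integral_eq]
    refine setIntegral_congr_ae h2o.measurableSet ?_
    filter_upwards [e2] with x hx hm
    rw [hx hm]

/-- Attainable averages are attained on every open set of finite measure, by arbitrarily small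
potentials. -/
theorem exists_isPotentialFor_of_mem_attainable [FiniteDimensional ℝ Z] [CompleteSpace Y] (hq : Continuous q) {z : Z} {y : Y}
    (hy : y ∈ attainable μ 𝓛 q R z) {Ω : Set E} (hΩ : IsOpen Ω) (hμ : μ Ω ≠ ⊤) {ε : ℝ}
    (hε : 0 < ε) : ∃ H, IsPotentialFor μ 𝓛 q R Ω ε z y H := by
  obtain ⟨H, hH⟩ := hy
  obtain ⟨C, hC⟩ := hH.lipschitz
  -- The balls lie in Ω and have radii below ε; the latter bounds the glued potential.
  obtain ⟨t, r, htc, htΩ, hr, hcov, hdisj⟩ := Besicovitch.exists_disjoint_closedBall_covering_ae μ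
    (fun x => {r | closedBall x r ⊆ Ω}) Ω (fun x hx δ hδ => by
      obtain ⟨s, hs0, hs⟩ := Metric.nhds_basis_closedBall.mem_iff.1 (hΩ.mem_nhds hx)
      refine ⟨min s (δ / 2), (closedBall_subset_closedBall (min_le_left _ _)).trans hs,
        lt_min hs0 (by linarith), (min_le_right _ _).trans_lt (by linarith)⟩) (fun _ => ε)
    (fun _ _ => hε)
  have hr0 (i : t) : 0 < r i := (hr i i.2).2.1
  have hrε (i : t) : r i < ε := (hr i i.2).2.2
  have hsub (i : t) : ball (i : E) (r i) ⊆ Ω := ball_subset_closedBall.trans (hr i i.2).1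
  let S : t → Set E := fun i => ball (i : E) (r i)
  have hS : Pairwise (Function.onFun Disjoint S) := fun i j hij =>
    (hdisj i.2 j.2 (fun h => hij (Subtype.ext h))).mono ball_subset_closedBall
      ball_subset_closedBall
  -- This scaling preserves both the values of the derivative and the Lipschitz constant, while the
  -- size shrinks by the factor `r i`.
  let f : t → E → T := fun i x => r i • H ((r i)⁻¹ • (x - i))
  have hmem (i : t) (x : E) : (r i)⁻¹ • (x - i) ∈ ball (0 : E) 1 ↔ x ∈ S i := by
    rw [mem_ball_zero_iff, norm_smul, norm_inv, Real.norm_eq_abs, abs_of_pos (hr0 i),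
      inv_mul_lt_iff₀ (hr0 i), mul_one, mem_ball_iff_norm]
  have hf (i : t) : LipschitzWith C (f i) := by
    refine LipschitzWith.of_dist_le_mul fun x y => ?_
    have := hC.dist_le_mul ((r i)⁻¹ • (x - i)) ((r i)⁻¹ • (y - i))
    rw [dist_smul₀, dist_sub_right, norm_inv, Real.norm_eq_abs, abs_of_pos (hr0 i)] at this
    simp only [f]
    rw [dist_smul₀, Real.norm_eq_abs, abs_of_pos (hr0 i)]
    calc r i * _ ≤ r i * (C * ((r i)⁻¹ * dist x y)) := mul_le_mul_of_nonneg_left this (hr0 i).le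
      _ = C * dist x y := by field_simp [(hr0 i).ne']
  have hf0 (i : t) (x : E) (hx : x ∉ S i) : f i x = 0 := by
    simp only [f]
    rw [hH.eq_zero _ (mt (hmem i x).1 hx), smul_zero]
  have hfd (i : t) (x : E) : fderiv ℝ (f i) x = fderiv ℝ H ((r i)⁻¹ • (x - i)) := by
    have h1 : f i = fun x => (fun w => r i • H ((r i)⁻¹ • w)) (x - i) := rfl
    rw [h1, fderiv_comp_sub (f := fun w => r i • H ((r i)⁻¹ • w))]
    change fderiv ℝ (r i • fun w => H ((r i)⁻¹ • w)) (x - i) = _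
    rw [fderiv_const_smul_field, Pi.smul_apply, fderiv_comp_smul, smul_inv_smul₀ (hr0 i).ne']
  obtain ⟨F, hFL, hFS, hF0⟩ := exists_lipschitzWith_glue hS hf hf0
  have hFd (i : t) (x : E) (hx : x ∈ S i) : fderiv ℝ F x = fderiv ℝ H ((r i)⁻¹ • (x - i)) := by
    rw [← hfd]
    refine Filter.EventuallyEq.fderiv_eq ?_
    filter_upwards [isOpen_ball.mem_nhds hx] with w hw using hFS i hw
  have : Countable t := htc.to_subtype
  have hΩS : ∀ᵐ x ∂μ, x ∈ Ω → ∃ i, x ∈ S i := by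
    have h1 : ∀ᵐ x ∂μ, x ∉ Ω \ ⋃ x ∈ t, closedBall x (r x) := by
      exact measure_eq_zero_iff_ae_notMem.1 hcov
    have h2 : ∀ᵐ x ∂μ, ∀ i : t, x ∉ sphere (i : E) (r i) := by
      refine ae_all_iff.2 fun i => ?_
      exact measure_eq_zero_iff_ae_notMem.1 (Measure.addHaar_sphere_of_ne_zero μ (i : E) (hr0 i).ne')
    filter_upwards [h1, h2] with x h1 h2 hx
    obtain ⟨i, hi, hxi⟩ : ∃ i ∈ t, x ∈ closedBall i (r i) := by
      by_contra! hcon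
      exact h1 ⟨hx, by simpa using hcon⟩
    refine ⟨⟨i, hi⟩, ?_⟩
    have := h2 ⟨i, hi⟩
    rw [← ball_union_sphere] at hxi
    exact hxi.resolve_right this
  have hnorm (i : t) : ∀ᵐ x ∂μ, x ∈ S i → ‖z + 𝓛 (fderiv ℝ F x)‖ < R := by
    have hqmp : ∀ᵐ x ∂μ, (r i)⁻¹ • (x - (i : E)) ∈ ball (0 : E) 1 →
        ‖z + 𝓛 (fderiv ℝ H ((r i)⁻¹ • (x - (i : E))))‖ < R := by
      have h := hH.norm_lt
      rw [ae_iff] at h ⊢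
      set N := {a | ¬(a ∈ ball (0 : E) 1 → ‖z + 𝓛 (fderiv ℝ H a)‖ < R)}
      have : {a | ¬((r i)⁻¹ • (a - (i : E)) ∈ ball (0 : E) 1 →
          ‖z + 𝓛 (fderiv ℝ H ((r i)⁻¹ • (a - (i : E))))‖ < R)} =
          (fun x => x + -(i : E)) ⁻¹' (((r i)⁻¹ • ·) ⁻¹' N) := by
        ext a
        simp only [N, sub_eq_add_neg, mem_preimage, mem_ofPred_eq]
      rw [this, measure_preimage_add_right,
        Measure.addHaar_preimage_smul μ (inv_ne_zero (hr0 i).ne'), h, mul_zero]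
    filter_upwards [hqmp] with x hx hxS
    rw [hFd i x hxS]
    exact hx ((hmem i x).2 hxS)
  have hlt : ∀ᵐ x ∂μ, x ∈ Ω → ‖z + 𝓛 (fderiv ℝ F x)‖ < R := by
    filter_upwards [hΩS, ae_all_iff.2 hnorm] with x hx hn hxΩ
    obtain ⟨i, hi⟩ := hx hxΩ
    exact hn i hi
  have hint := integrableOn_comp_fderiv hq hΩ.measurableSet hμ hlt
  have hUΩ : (⋃ i, S i) ⊆ Ω := iUnion_subset hsub
  have hae : Ω =ᵐ[μ] ⋃ i, S i := by
    filter_upwards [hΩS] with x hx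
    exact propext ⟨fun h => mem_iUnion.2 (hx h), fun h => hUΩ h⟩
  have hball (i : t) : ∫ x in S i, q (z + 𝓛 (fderiv ℝ F x)) ∂μ = ∫ _ in S i, y ∂μ := by
    set g : E → Y := (ball (0 : E) 1).indicator fun x => q (z + 𝓛 (fderiv ℝ H x))
    have h1 : ∫ x in S i, q (z + 𝓛 (fderiv ℝ F x)) ∂μ = ∫ x, g ((r i)⁻¹ • (x - i)) ∂μ := by
      rw [← integral_indicator measurableSet_ball]
      congr 1
      ext x
      by_cases hx : x ∈ S i
      · simp only [g]
        rw [indicator_of_mem hx, indicator_of_mem ((hmem i x).2 hx), hFd i x hx]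
      · simp only [g]
        rw [indicator_of_notMem hx, indicator_of_notMem (mt (hmem i x).1 hx)]
    rw [h1, integral_sub_right_eq_self (fun x => g ((r i)⁻¹ • x)),
      Measure.integral_comp_inv_smul_of_nonneg μ g (hr0 i).le,
      integral_indicator measurableSet_ball, hH.integral_eq, setIntegral_const,
      measureReal_ball_of_pos μ _ (hr0 i), smul_smul]
  refine ⟨F, ⟨_, hFL⟩, fun x hx => hF0 x fun i hi => hx (hsub i hi), fun x => ?_, hlt, ?_⟩
  · by_cases hx : ∃ i, x ∈ S i
    · obtain ⟨i, hi⟩ := hx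
      rw [hFS i hi, norm_smul, Real.norm_eq_abs, abs_of_pos (hr0 i)]
      nlinarith [hH.norm_le ((r i)⁻¹ • (x - i)), hr0 i, hrε i]
    · rw [hF0 x (by simpa using hx), norm_zero]
      exact hε.le
  · rw [← setIntegral_const, setIntegral_congr_set hae, setIntegral_congr_set hae,
      integral_iUnion (fun i => measurableSet_ball) hS (hint.mono_set hUΩ),
      integral_iUnion (fun i => measurableSet_ball) hS
        ((integrableOn_const hμ).mono_set hUΩ)]
    exact tsum_congr hball

end Attains

/-- If the closure has an interior point, s spans the whole space, since affine subspaces are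
closed; then s has nonempty interior, which coincides with that of its closure. This is what turns
approximate attainment into exact attainment. -/
theorem Convex.interior_closure_subset {Y : Type*} [NormedAddCommGroup Y] [NormedSpace ℝ Y]
    [FiniteDimensional ℝ Y] {s : Set Y} (hs : Convex ℝ s) : interior (closure s) ⊆ s := by
  rcases (interior (closure s)).eq_empty_or_nonempty with h | h
  · simp [h]
  have hsub : closure s ⊆ affineSpan ℝ s :=
    closure_minimal (subset_affineSpan ℝ s) (AffineSubspace.closed_of_finiteDimensional _)
  have htop : affineSpan ℝ s = ⊤ := by
    have h1 := isOpen_interior.affineSpan_eq_top h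
    rw [eq_top_iff, ← h1]
    exact affineSpan_le.2 (interior_subset.trans hsub)
  rw [hs.interior_closure_eq_interior_of_nonempty_interior
    (hs.interior_nonempty_iff_affineSpan_eq_top.2 htop)]
  exact interior_subset

theorem setIntegral_eq_add_add_diff {E F : Type*} [TopologicalSpace E]
    [MeasurableSpace E] [OpensMeasurableSpace E] [NormedAddCommGroup F] [NormedSpace ℝ F]
    {μ : Measure E}
    {f : E → F} {Ω Ω₁ Ω₂ : Set E} (h1o : IsOpen Ω₁) (h2o : IsOpen Ω₂) (hd : Disjoint Ω₁ Ω₂)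
    (h1 : Ω₁ ⊆ Ω) (h2 : Ω₂ ⊆ Ω) (hΩ : MeasurableSet Ω) (hf : IntegrableOn f Ω μ) :
    ∫ x in Ω, f x ∂μ =
      ∫ x in Ω₁, f x ∂μ + ∫ x in Ω₂, f x ∂μ + ∫ x in Ω \ (Ω₁ ∪ Ω₂), f x ∂μ := by
  rw [← setIntegral_union hd h2o.measurableSet (hf.mono_set h1) (hf.mono_set h2),
    ← setIntegral_union disjoint_sdiff_right (hΩ.diff (h1o.union h2o).measurableSet)
      (hf.mono_set (union_subset h1 h2)) (hf.mono_set sdiff_subset),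
    union_sdiff_cancel (union_subset h1 h2)]

theorem mem_attainable_self {E T Z Y : Type*} [NormedAddCommGroup E] [NormedSpace ℝ E]
    [MeasurableSpace E] [NormedAddCommGroup T] [NormedSpace ℝ T] [NormedAddCommGroup Z]
    [NormedSpace ℝ Z] [NormedAddCommGroup Y] [NormedSpace ℝ Y] [CompleteSpace Y] {μ : Measure E}
    {𝓛 : (E →L[ℝ] T) →L[ℝ] Z} {q : Z → Y} {R : ℝ} {z : Z} (hz : ‖z‖ < R) : q z ∈ attainable μ 𝓛 q R z := by
  refine ⟨fun _ => 0, ⟨0, LipschitzWith.const 0⟩, fun _ _ => rfl, fun _ => by simp, ?_, ?_⟩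
  · filter_upwards with x _
    simpa using hz
  · simp

/-! ### Convexity of the attainable set, in y and jointly in (z, y) -/

section Attainable

variable {E T Z Y : Type*} [NormedAddCommGroup E] [NormedSpace ℝ E] [FiniteDimensional ℝ E]
  [MeasurableSpace E] [BorelSpace E]
  [NormedAddCommGroup T] [NormedSpace ℝ T] [FiniteDimensional ℝ T]
  [NormedAddCommGroup Z] [NormedSpace ℝ Z] [FiniteDimensional ℝ Z]
  [NormedAddCommGroup Y] [NormedSpace ℝ Y] [FiniteDimensional ℝ Y]
  {μ : Measure E} [μ.IsAddHaarMeasure] {𝓛 : (E →L[ℝ] T) →L[ℝ] Z} {q : Z → Y} {R : ℝ}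

/-- With z fixed no plane wave is needed: the ball is cut into a concentric ball of volume fraction
a and a shell, and each carries its own potential. The dimension must be positive for such a radius
to exist. -/
theorem convex_attainable [Nontrivial E] (hq : Continuous q) (z : Z) :
    Convex ℝ (attainable μ 𝓛 q R z) := by
  rw [convex_iff_forall_pos]
  intro y₁ hy₁ y₂ hy₂ a b ha hb hab
  have hd : Module.finrank ℝ E ≠ 0 := (Module.finrank_pos (R := ℝ) (M := E)).ne'
  obtain ⟨r, hr0, hr1, hr⟩ : ∃ r : ℝ, 0 < r ∧ r < 1 ∧ r ^ Module.finrank ℝ E = a :=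
    ⟨a ^ ((Module.finrank ℝ E : ℝ)⁻¹), by positivity,
      Real.rpow_lt_one ha.le (by linarith) (by positivity), Real.rpow_inv_natCast_pow ha.le hd⟩
  set Ω₁ : Set E := ball 0 r
  set Ω₂ : Set E := ball 0 1 \ closedBall 0 r
  have h1o : IsOpen Ω₁ := isOpen_ball
  have h2o : IsOpen Ω₂ := isOpen_ball.sdiff isClosed_closedBall
  have h1 : Ω₁ ⊆ ball 0 1 := ball_subset_ball hr1.le
  have h2 : Ω₂ ⊆ ball 0 1 := sdiff_subset
  have hdis : Disjoint Ω₁ Ω₂ := disjoint_sdiff_right.mono_left ball_subset_closedBall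
  have hfin : μ (ball (0 : E) 1) ≠ ⊤ := measure_ball_lt_top.ne
  obtain ⟨H₁, hH₁⟩ := exists_isPotentialFor_of_mem_attainable hq hy₁ h1o
    (measure_ne_top_of_subset h1 hfin) one_pos
  obtain ⟨H₂, hH₂⟩ := exists_isPotentialFor_of_mem_attainable hq hy₂ h2o
    (measure_ne_top_of_subset h2 hfin) one_pos
  obtain ⟨H, hL, h0, hb', hn1, hn2, -, hi1, hi2⟩ := exists_patch (ε₀ := 0) (z := z)
    (H₀ := fun _ => 0) h1o h2o
    hdis h1 h2 ⟨0, LipschitzWith.const 0⟩ (fun _ _ => rfl) (fun _ => by simp)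
    (by filter_upwards with x _; simp) (by filter_upwards with x _; simp) hH₁ hH₂
  have hnull : μ (ball 0 1 \ (Ω₁ ∪ Ω₂)) = 0 := by
    refine measure_mono_null ?_ (Measure.addHaar_sphere_of_ne_zero μ (0 : E) hr0.ne')
    rintro x ⟨hx, hx'⟩
    simp only [Ω₁, Ω₂, mem_union, Set.mem_sdiff, not_or, not_and, not_not] at hx'
    rw [← closedBall_sdiff_ball]
    exact ⟨hx'.2 hx, hx'.1⟩
  have hn : ∀ᵐ x ∂μ, x ∈ ball (0 : E) 1 → ‖z + 𝓛 (fderiv ℝ H x)‖ < R := by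
    filter_upwards [hn1, hn2, measure_eq_zero_iff_ae_notMem.1 hnull] with x hx1 hx2 hx hxb
    by_contra hcon
    exact hx ⟨hxb, fun h => hcon (h.elim hx1 hx2)⟩
  have hm1 : μ.real Ω₁ = a * μ.real (ball (0 : E) 1) := by
    rw [measureReal_ball_of_pos μ 0 hr0, hr]
  have hm2 : μ.real Ω₂ = b * μ.real (ball (0 : E) 1) := by
    rw [measureReal_sdiff (closedBall_subset_ball hr1) measurableSet_closedBall,
      Measure.addHaar_real_closedBall_eq_addHaar_real_ball, hm1, eq_sub_of_add_eq' hab]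
    ring
  refine ⟨H, hL, h0, fun x => by simpa using hb' x, hn, ?_⟩
  rw [setIntegral_eq_add_add_diff h1o h2o hdis h1 h2 measurableSet_ball
    (integrableOn_comp_fderiv hq measurableSet_ball hfin hn), hi1, hi2,
    Measure.restrict_eq_zero.2 hnull, integral_zero_measure, add_zero, hm1, hm2]
  module

/-- The set of attainable averages is approximately convex jointly in the mean field and the
average, as soon as every direction is a plane wave direction. -/
theorem exists_mem_attainable_near (hq : Continuous q)
    (hw : ∀ ζ : Z, ∃ (ξ : E →L[ℝ] ℝ) (A : T), ξ ≠ 0 ∧ 𝓛 (ξ.smulRight A) = ζ)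
    {z₁ z₂ : Z} {y₁ y₂ : Y} (hz₁ : ‖z₁‖ < R) (hz₂ : ‖z₂‖ < R)
    (hy₁ : y₁ ∈ attainable μ 𝓛 q R z₁) (hy₂ : y₂ ∈ attainable μ 𝓛 q R z₂) {t : ℝ}
    (ht0 : 0 < t) (ht1 : t < 1) {δ : ℝ} (hδ : 0 < δ) :
    ∃ y ∈ attainable μ 𝓛 q R (t • z₁ + (1 - t) • z₂),
      ‖y - (t • y₁ + (1 - t) • y₂)‖ ≤ δ := by
  set z := t • z₁ + (1 - t) • z₂ with hz_def
  have hz : ‖z‖ < R := by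
    have := (convex_ball (0 : Z) R) (mem_ball_zero_iff.2 hz₁) (mem_ball_zero_iff.2 hz₂) ht0.le
      (by linarith : 0 ≤ 1 - t) (by ring)
    exact mem_ball_zero_iff.1 this
  -- Slopes 1 - t and -t along this wave move z exactly to z₁ and z₂.
  obtain ⟨ξ, A, hξ, hξA⟩ := hw (z₁ - z₂)
  obtain ⟨Cq, hCq0, hCq⟩ := exists_norm_le_of_norm_lt hq R
  -- The first bound leaves half of the allowed size 1 for the potentials inside the layers; the
  -- second keeps the field in the ball of radius R where the cutoff acts.
  obtain ⟨κ, hκ0, hκA, hκL⟩ : ∃ κ : ℝ, 0 < κ ∧ κ * ‖A‖ < 1 / 2 ∧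
      ‖𝓛‖ * (κ * ‖A‖) < R - ‖z‖ := by
    have h1 : ∀ᶠ κ : ℝ in 𝓝[>] 0, κ * ‖A‖ < 1 / 2 := by
      have : Tendsto (fun κ : ℝ => κ * ‖A‖) (𝓝[>] 0) (𝓝 (0 * ‖A‖)) :=
        ((continuous_mul_const ‖A‖).tendsto 0).mono_left nhdsWithin_le_nhds
      exact this.eventually (gt_mem_nhds (by norm_num))
    have h2 : ∀ᶠ κ : ℝ in 𝓝[>] 0, ‖𝓛‖ * (κ * ‖A‖) < R - ‖z‖ := by
      have hc : Continuous fun κ : ℝ => ‖𝓛‖ * (κ * ‖A‖) := by fun_prop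
      have : Tendsto (fun κ : ℝ => ‖𝓛‖ * (κ * ‖A‖)) (𝓝[>] 0) (𝓝 (‖𝓛‖ * (0 * ‖A‖))) :=
        (hc.tendsto 0).mono_left nhdsWithin_le_nhds
      exact this.eventually (gt_mem_nhds (by simpa using hz))
    obtain ⟨κ, ⟨h1, h2⟩, h3⟩ := ((h1.and h2).and self_mem_nhdsWithin).exists
    exact ⟨κ, h3, h1, h2⟩
  set B : Set E := ball 0 1
  have hfin : μ B ≠ ⊤ := measure_ball_lt_top.ne
  set m := μ.real B with hm_def
  have hm : 0 < m := ENNReal.toReal_pos (measure_ball_pos μ 0 one_pos).ne' hfin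
  have hξn : 0 < ‖ξ‖ := norm_pos_iff.2 hξ
  -- With m₃ the volume outside the layers, `K * m₃` bounds the imbalance of the layer volumes and
  -- `Q * m₃` the total error in the integral of q; the choice of m₃ below `m * δ / (Q + 1)` then
  -- yields δ.
  set K := (κ + ‖ξ‖) / ‖ξ‖ with hK
  have hK0 : 0 ≤ K := by positivity
  set Q := (K + 1) * (‖y₁‖ + ‖y₂‖) + Cq with hQ
  have hQ0 : 0 ≤ Q := by positivity
  obtain ⟨u, Ω₁, Ω₂, ⟨C, hu⟩, hub, hu0, h1o, h2o, hdis, h1, h2, hu1, hu2, hae, hη⟩ :=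
    exists_planeWave μ hξ ht0 ht1 hκ0 (by positivity : 0 < m * δ / (Q + 1))
  set Ω₃ := B \ (Ω₁ ∪ Ω₂)
  have hΩ₃ : MeasurableSet Ω₃ := measurableSet_ball.diff (h1o.union h2o).measurableSet
  have hfin3 : μ Ω₃ ≠ ⊤ := measure_ne_top_of_subset sdiff_subset hfin
  set m₁ := μ.real Ω₁ with hm₁
  set m₂ := μ.real Ω₂ with hm₂
  set m₃ := μ.real Ω₃ with hm₃
  have hm3 : 0 ≤ m₃ := measureReal_nonneg
  have hsum : m₁ + m₂ + m₃ = m := by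
    have := setIntegral_eq_add_add_diff (μ := μ) (f := fun _ => (1 : ℝ)) h1o h2o hdis h1 h2
      measurableSet_ball (integrableOn_const hfin)
    simpa using this.symm
  -- the volume fractions are determined by the zero mean of the gradient
  have hbd : ∀ᵐ x ∂μ, ‖fderiv ℝ u x‖ ≤ κ + ‖ξ‖ := by
    filter_upwards [hae] with x hx
    have h0 := norm_nonneg ξ
    rcases hx with h | h | h
    · linarith
    · rw [h, norm_smul, Real.norm_eq_abs, abs_of_pos (by linarith)]
      nlinarith
    · rw [h, norm_smul, Real.norm_eq_abs, abs_neg, abs_of_pos ht0]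
      nlinarith
  have hint : IntegrableOn (fderiv ℝ u) B μ := by
    have := integrableOn_comp_fderiv (μ := μ) (𝓛 := ContinuousLinearMap.id ℝ (E →L[ℝ] ℝ))
      (q := id) (R := κ + ‖ξ‖ + 1) (z := 0) (H := u) continuous_id measurableSet_ball hfin (by
        filter_upwards [hbd] with x hx _
        simpa using lt_of_le_of_lt hx (lt_add_one _))
    simpa using this
  have hzero : ∫ x in B, fderiv ℝ u x ∂μ = 0 := by
    rw [setIntegral_eq_integral_of_ae_compl_eq_zero]
    · refine hu.integral_fderiv_eq_zero_of_real (HasCompactSupport.intro (isCompact_closedBall 0 1) ?_)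
      exact fun x hx => hu0 x fun h => hx (ball_subset_closedBall h)
    · filter_upwards [hu.ae_fderiv_eq_zero_of_eq_zero (μ := μ)] with x hx hxB
      exact hx (hu0 x hxB)
  have he : |m₁ * (1 - t) - m₂ * t| ≤ K * m₃ := by
    rw [setIntegral_eq_add_add_diff h1o h2o hdis h1 h2 measurableSet_ball hint,
      setIntegral_congr_fun h1o.measurableSet hu1, setIntegral_congr_fun h2o.measurableSet hu2,
      setIntegral_const, setIntegral_const] at hzero
    have h3 : ‖∫ x in Ω₃, fderiv ℝ u x ∂μ‖ ≤ (κ + ‖ξ‖) * m₃ :=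
      norm_setIntegral_le_of_norm_le_const_ae hfin3.lt_top (ae_restrict_of_ae hbd)
    have h4 : (m₁ * (1 - t) - m₂ * t) • ξ = -∫ x in Ω₃, fderiv ℝ u x ∂μ := by
      rw [eq_neg_iff_add_eq_zero, ← hzero]
      module
    have h5 := congrArg norm h4
    rw [norm_neg, norm_smul, Real.norm_eq_abs] at h5
    rw [hK, div_mul_eq_mul_div, le_div_iff₀ hξn, h5]
    exact h3
  -- the patched potential
  set H₀ : E → T := fun x => u x • A
  have hH₀L : LipschitzWith (C * ‖A‖₊) H₀ := by
    refine LipschitzWith.of_dist_le_mul fun x y => ?_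
    simp only [H₀, dist_eq_norm, ← sub_smul, norm_smul]
    have := hu.dist_le_mul x y
    rw [dist_eq_norm, dist_eq_norm] at this
    calc ‖u x - u y‖ * ‖A‖ ≤ (C * ‖x - y‖) * ‖A‖ :=
          mul_le_mul_of_nonneg_right this (norm_nonneg _)
      _ = _ := by push_cast; ring
  have hH₀d : ∀ᵐ x ∂μ, 𝓛 (fderiv ℝ H₀ x) = 𝓛 ((fderiv ℝ u x).smulRight A) := by
    filter_upwards [hu.ae_differentiableAt (μ := μ)] with x hx
    rw [(hx.hasFDerivAt.smul_const A).fderiv]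
  have hcase1 : z + 𝓛 (((1 - t) • ξ).smulRight A) = z₁ := by
    have : ((1 - t) • ξ).smulRight A = (1 - t) • ξ.smulRight A := by
      ext v; simp [mul_smul]
    rw [this, map_smul, hξA, hz_def]
    module
  have hcase2 : z + 𝓛 (((-t) • ξ).smulRight A) = z₂ := by
    have : ((-t) • ξ).smulRight A = (-t) • ξ.smulRight A := by
      ext v; simp [mul_smul]
    rw [this, map_smul, hξA, hz_def]
    module
  have hH₀n : ∀ᵐ x ∂μ, ‖z + 𝓛 (fderiv ℝ H₀ x)‖ < R := by
    filter_upwards [hH₀d, hae] with x hx hx'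
    rw [hx]
    rcases hx' with h | h | h
    · have h6 : ‖𝓛 ((fderiv ℝ u x).smulRight A)‖ ≤ ‖𝓛‖ * (κ * ‖A‖) := by
        refine (𝓛.le_opNorm _).trans (mul_le_mul_of_nonneg_left ?_ (norm_nonneg _))
        rw [ContinuousLinearMap.norm_smulRight_apply]
        exact mul_le_mul_of_nonneg_right h (norm_nonneg _)
      linarith [norm_add_le z (𝓛 ((fderiv ℝ u x).smulRight A))]
    · rw [h, hcase1]
      exact hz₁
    · rw [h, hcase2]
      exact hz₂
  obtain ⟨H₁, hH₁⟩ := exists_isPotentialFor_of_mem_attainable hq hy₁ h1o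
    (measure_ne_top_of_subset h1 hfin) one_half_pos
  obtain ⟨H₂, hH₂⟩ := exists_isPotentialFor_of_mem_attainable hq hy₂ h2o
    (measure_ne_top_of_subset h2 hfin) one_half_pos
  obtain ⟨H, hL, h0, hb, hn1, hn2, hn3, hi1, hi2⟩ := exists_patch (ε₀ := 1 / 2) (z := z)
    h1o h2o hdis h1 h2 ⟨_, hH₀L⟩ (fun x hx => by simp [H₀, hu0 x hx])
    (fun x => by
      rw [norm_smul]
      exact (mul_le_mul_of_nonneg_right (hub x) (norm_nonneg A)).trans hκA.le)
    (by
      filter_upwards [hH₀d] with x hx hm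
      rw [hx, hu1 x hm, hcase1])
    (by
      filter_upwards [hH₀d] with x hx hm
      rw [hx, hu2 x hm, hcase2]) hH₁ hH₂
  have hn : ∀ᵐ x ∂μ, x ∈ B → ‖z + 𝓛 (fderiv ℝ H x)‖ < R := by
    filter_upwards [hn1, hn2, hn3, hH₀n] with x hx1 hx2 hx3 hx0 hxb
    by_cases hm1 : x ∈ Ω₁
    · exact hx1 hm1
    by_cases hm2 : x ∈ Ω₂
    · exact hx2 hm2
    rw [hx3 hm1 hm2]
    exact hx0
  set I := ∫ x in Ω₃, q (z + 𝓛 (fderiv ℝ H x)) ∂μ with hI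
  have hIb : ‖I‖ ≤ Cq * m₃ := by
    refine norm_setIntegral_le_of_norm_le_const_ae hfin3.lt_top ?_
    rw [ae_restrict_iff' hΩ₃]
    filter_upwards [hn] with x hx hx3 using hCq _ (hx hx3.1)
  have htot : ∫ x in B, q (z + 𝓛 (fderiv ℝ H x)) ∂μ = m₁ • y₁ + m₂ • y₂ + I := by
    rw [setIntegral_eq_add_add_diff h1o h2o hdis h1 h2 measurableSet_ball
      (integrableOn_comp_fderiv hq measurableSet_ball hfin hn), hi1, hi2]
  refine ⟨m⁻¹ • (m₁ • y₁ + m₂ • y₂ + I), ⟨H, hL, h0, fun x => ?_, hn, ?_⟩, ?_⟩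
  · linarith [hb x]
  · rw [htot, smul_inv_smul₀ hm.ne']
  · have h7 : m⁻¹ • (m₁ • y₁ + m₂ • y₂ + I) - (t • y₁ + (1 - t) • y₂) =
        m⁻¹ • ((m₁ - t * m) • y₁ + (m₂ - (1 - t) * m) • y₂ + I) := by
      rw [eq_inv_smul_iff₀ hm.ne', smul_sub, smul_inv_smul₀ hm.ne']
      module
    have h8 : |m₁ - t * m| ≤ (K + 1) * m₃ := by
      have h : m₁ - t * m = (m₁ * (1 - t) - m₂ * t) - t * m₃ := by rw [← hsum]; ring
      have h' := abs_sub (m₁ * (1 - t) - m₂ * t) (t * m₃)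
      rw [abs_of_nonneg (mul_nonneg ht0.le hm3), ← h] at h'
      linarith [mul_nonneg (sub_nonneg.2 ht1.le) hm3]
    have h9 : |m₂ - (1 - t) * m| ≤ (K + 1) * m₃ := by
      have h : m₂ - (1 - t) * m = -(m₁ * (1 - t) - m₂ * t) - (1 - t) * m₃ := by
        rw [← hsum]; ring
      have h' := abs_sub (-(m₁ * (1 - t) - m₂ * t)) ((1 - t) * m₃)
      rw [abs_of_nonneg (mul_nonneg (sub_nonneg.2 ht1.le) hm3), ← h, abs_neg] at h'
      linarith [mul_nonneg ht0.le hm3]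
    rw [h7, norm_smul, norm_inv, Real.norm_eq_abs, abs_of_pos hm, inv_mul_le_iff₀ hm]
    have h10 : ‖(m₁ - t * m) • y₁ + (m₂ - (1 - t) * m) • y₂ + I‖ ≤ Q * m₃ := by
      refine (norm_add₃_le).trans ?_
      rw [norm_smul, norm_smul, Real.norm_eq_abs, Real.norm_eq_abs]
      have := mul_le_mul_of_nonneg_right h8 (norm_nonneg y₁)
      have := mul_le_mul_of_nonneg_right h9 (norm_nonneg y₂)
      rw [hQ]
      linarith
    rw [lt_div_iff₀ (by positivity)] at hη
    nlinarith

/-- Every interior point of the convex hull of the graph of `q` over a ball is attained. -/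
theorem mem_attainable_of_mem_interior_convexHull [Nontrivial E] (hq : Continuous q)
    (hw : ∀ ζ : Z, ∃ (ξ : E →L[ℝ] ℝ) (A : T), ξ ≠ 0 ∧ 𝓛 (ξ.smulRight A) = ζ) {z : Z} {y : Y}
    (h : (z, y) ∈ interior (convexHull ℝ {p : Z × Y | ‖p.1‖ < R ∧ p.2 = q p.1})) :
    y ∈ attainable μ 𝓛 q R z := by
  -- The closure is essential: lamination gives convex combinations only up to an error.
  set S : Set (Z × Y) := {p | ‖p.1‖ < R ∧ p.2 ∈ closure (attainable μ 𝓛 q R p.1)}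
  have hS : Convex ℝ S := by
    rw [convex_iff_forall_pos]
    rintro ⟨z₁, y₁⟩ ⟨hz₁, hy₁⟩ ⟨z₂, y₂⟩ ⟨hz₂, hy₂⟩ a b ha hb hab
    obtain rfl : b = 1 - a := by linarith
    refine ⟨?_, ?_⟩
    · have := (convex_ball (0 : Z) R) (mem_ball_zero_iff.2 hz₁) (mem_ball_zero_iff.2 hz₂) ha.le
        hb.le hab
      exact mem_ball_zero_iff.1 this
    · change a • y₁ + (1 - a) • y₂ ∈ closure (attainable μ 𝓛 q R (a • z₁ + (1 - a) • z₂))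
      rw [Metric.mem_closure_iff] at hy₁ hy₂ ⊢
      intro ε hε
      obtain ⟨w₁, hw₁, hd₁⟩ := hy₁ (ε / 2) (by linarith)
      obtain ⟨w₂, hw₂, hd₂⟩ := hy₂ (ε / 2) (by linarith)
      obtain ⟨w, hwm, hd⟩ := exists_mem_attainable_near hq hw hz₁ hz₂ hw₁ hw₂ ha
        (by linarith : a < 1) (by linarith : 0 < ε / 2)
      refine ⟨w, hwm, ?_⟩
      change dist y₁ w₁ < ε / 2 at hd₁
      change dist y₂ w₂ < ε / 2 at hd₂
      rw [dist_eq_norm] at hd₁ hd₂ ⊢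
      have h1 : a • y₁ + (1 - a) • y₂ - w =
          a • (y₁ - w₁) + (1 - a) • (y₂ - w₂) - (w - (a • w₁ + (1 - a) • w₂)) := by
        module
      rw [h1]
      refine (norm_sub_le _ _).trans_lt ?_
      have h2 := norm_add_le (a • (y₁ - w₁)) ((1 - a) • (y₂ - w₂))
      rw [norm_smul, norm_smul, Real.norm_eq_abs, Real.norm_eq_abs, abs_of_pos ha,
        abs_of_pos hb] at h2
      nlinarith
  have hsub : convexHull ℝ {p : Z × Y | ‖p.1‖ < R ∧ p.2 = q p.1} ⊆ S := by
    refine convexHull_min ?_ hS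
    rintro ⟨w, v⟩ ⟨hw, hv⟩
    refine ⟨hw, subset_closure ?_⟩
    rw [hv]
    exact mem_attainable_self hw
  -- The slice at z of the open interior of the hull is a neighbourhood of y inside the closure of
  -- the attainable set.
  refine (convex_attainable hq z).interior_closure_subset (mem_interior.2
    ⟨(fun v => (z, v)) ⁻¹' interior (convexHull ℝ {p : Z × Y | ‖p.1‖ < R ∧ p.2 = q p.1}),
      fun v hv => (hsub (interior_subset hv)).2, ?_, h⟩)
  exact isOpen_interior.preimage (by fun_prop)

end Attainable

/-! ### Zero mean for vector potentials, and a uniform bound by compactness -/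

theorem LipschitzWith.integral_fderiv_eq_zero {E T : Type*} [NormedAddCommGroup E]
    [NormedSpace ℝ E] [FiniteDimensional ℝ E] [MeasurableSpace E] [BorelSpace E] {μ : Measure E}
    [μ.IsAddHaarMeasure] [NormedAddCommGroup T] [NormedSpace ℝ T] [FiniteDimensional ℝ T]
    {C : ℝ≥0} {H : E → T} (hH : LipschitzWith C H) (hc : HasCompactSupport H) :
    ∫ x, fderiv ℝ H x ∂μ = 0 := by
  by_cases hi : Integrable (fderiv ℝ H) μ
  swap
  · exact integral_undef hi
  ext v
  refine SeparatingDual.eq_zero_of_forall_dual_eq_zero (R := ℝ) fun c => ?_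
  have hcl := c.lipschitz.comp hH
  have h0 := hcl.integral_fderiv_eq_zero_of_real (μ := μ) (hc.comp_left (map_zero c))
  have h1 : ∫ x, fderiv ℝ (c ∘ H) x ∂μ = ∫ x, c.comp (fderiv ℝ H x) ∂μ := by
    refine integral_congr_ae ?_
    filter_upwards [hH.ae_differentiableAt (μ := μ)] with x hx
    rw [fderiv_comp x c.differentiableAt hx, c.fderiv]
  have h2 : ∫ x, c.comp (fderiv ℝ H x) ∂μ = c.comp (∫ x, fderiv ℝ H x ∂μ) :=
    (ContinuousLinearMap.compL ℝ E T ℝ c).integral_comp_comm hi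
  rw [← ContinuousLinearMap.comp_apply, ← h2, ← h1, h0, zero_apply]

/-- A compact subset of the interior of the convex hull of a graph lies in the interior of the
convex hull of a bounded piece of the graph. -/
theorem exists_subset_interior_convexHull_graph {Z Y : Type*} [NormedAddCommGroup Z]
    [NormedSpace ℝ Z] [FiniteDimensional ℝ Z] [NormedAddCommGroup Y] [NormedSpace ℝ Y]
    [FiniteDimensional ℝ Y] {q : Z → Y} {L : Set (Z × Y)} (hL : IsCompact L)
    (h : L ⊆ interior (convexHull ℝ {p : Z × Y | p.2 = q p.1})) :
    ∃ R : ℝ, L ⊆ interior (convexHull ℝ {p : Z × Y | ‖p.1‖ < R ∧ p.2 = q p.1}) := by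
  set G : ℝ → Set (Z × Y) := fun R => {p : Z × Y | ‖p.1‖ < R ∧ p.2 = q p.1}
  have hmono : Monotone fun R => convexHull ℝ (G R) := fun R R' hR =>
    convexHull_mono fun p hp => ⟨hp.1.trans_le hR, hp.2⟩
  have hU : convexHull ℝ {p : Z × Y | p.2 = q p.1} ⊆ ⋃ R, convexHull ℝ (G R) := by
    refine convexHull_min (fun p hp => ?_) ?_
    · exact mem_iUnion.2 ⟨‖p.1‖ + 1, subset_convexHull ℝ _ ⟨lt_add_one _, hp⟩⟩
    · exact (hmono.directed_le).convex_iUnion fun R => convex_convexHull ℝ _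
  have hp : ∀ p ∈ L, ∃ R, p ∈ interior (convexHull ℝ (G R)) := by
    intro p hpL
    -- An interior point lies in the interior of a polytope contained in the hull; its finitely many
    -- vertices already belong to the hull of one bounded piece.
    obtain ⟨t, hpt, ht⟩ := (convex_singleton p).exists_subset_interior_convexHull_finset_of_isCompact
      isCompact_singleton (nhdsSet_singleton (x := p) ▸ mem_interior_iff_mem_nhds.1 (h hpL))
    have hex : ∀ p ∈ t, ∃ R, p ∈ convexHull ℝ (G R) := fun p hp =>
      mem_iUnion.1 (hU (ht (subset_convexHull ℝ _ hp)))
    choose! r hr using hex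
    obtain ⟨R, hR⟩ := (t.image r).bddAbove
    refine ⟨R, interior_mono (convexHull_min (fun p hp => ?_) (convex_convexHull ℝ _))
      (hpt rfl)⟩
    exact hmono (hR (Finset.mem_coe.2 (Finset.mem_image_of_mem r hp))) (hr p hp)
  obtain ⟨R, hR⟩ := hL.elim_directed_cover (fun R => interior (convexHull ℝ (G R)))
    (fun _ => isOpen_interior) (fun p hpL => mem_iUnion.2 (hp p hpL))
    (Monotone.directed_le fun R R' hRR' => interior_mono (hmono hRR'))
  exact ⟨R, hR⟩

/-! ### The Born–Infeld case: skew potentials, wave directions, graph structure -/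

namespace BornInfeld

/-- The pairs `(D, B)`. -/
abbrev Field : Type := Fin 2 → Space

/-- The skew-symmetric matrix with axial vector `a`. -/
def skew (a : Space) : Matrix (Fin 3) (Fin 3) ℝ :=
  !![0, a 2, -a 1; -a 2, 0, a 0; a 1, -a 0, 0]

theorem skew_apply_comm (a : Space) (i j : Fin 3) : skew a i j = -skew a j i := by
  fin_cases i <;> fin_cases j <;> simp [skew]

theorem skew_zero : skew 0 = 0 := by
  ext i j
  fin_cases i <;> fin_cases j <;> simp [skew]

theorem skew_add (a b : Space) (i j : Fin 3) : skew (a + b) i j = skew a i j + skew b i j := by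
  fin_cases i <;> fin_cases j <;> simp [skew] <;> ring

theorem skew_smul (c : ℝ) (a : Space) (i j : Fin 3) : skew (c • a) i j = c * skew a i j := by
  fin_cases i <;> fin_cases j <;> simp [skew]

theorem abs_skew_le (a : Space) (i j : Fin 3) : |skew a i j| ≤ ‖a‖ := by
  have h (l : Fin 3) : |a l| ≤ ‖a‖ := PiLp.norm_apply_le a l
  fin_cases i <;> fin_cases j <;> simp [skew, h]

/-- An entry of the skew-symmetric matrices attached to a pair of vectors. -/
noncomputable def skewEntry (k : Fin 2) (i j : Fin 3) : Field →L[ℝ] ℝ :=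
  LinearMap.toContinuousLinearMap
    { toFun := fun a => skew (a k) i j
      map_add' := fun a b => skew_add (a k) (b k) i j
      map_smul' := fun c a => skew_smul c (a k) i j }

theorem skewEntry_apply (k : Fin 2) (i j : Fin 3) (a : Field) :
    skewEntry k i j a = skew (a k) i j := rfl

/-- The divergence of a pair of skew-symmetric matrix fields, as a function of the derivative of
the pair of axial vector fields. -/
noncomputable def divSkew : (Space →L[ℝ] Field) →L[ℝ] Field :=
  LinearMap.toContinuousLinearMap
    { toFun := fun A k => WithLp.toLp 2 fun j =>
        ∑ i, skewEntry k i j (A (EuclideanSpace.single i 1))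
      map_add' := fun A B => by
        ext k j
        simp [Finset.sum_add_distrib]
      map_smul' := fun c A => by
        ext k j
        simp [Finset.mul_sum] }

theorem divSkew_apply (A : Space →L[ℝ] Field) (k : Fin 2) (j : Fin 3) :
    divSkew A k j = ∑ i, skewEntry k i j (A (EuclideanSpace.single i 1)) := rfl

/-- Every pair of vectors is the amplitude of a plane wave. -/
theorem exists_divSkew_smulRight_eq (ζ : Field) :
    ∃ (ξ : Space →L[ℝ] ℝ) (A : Field), ξ ≠ 0 ∧ divSkew (ξ.smulRight A) = ζ := by
  -- One direction must serve both D and B: two linear conditions on ℝ³ leave a nonzero n.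
  obtain ⟨n, hn, hn0⟩ : ∃ n : Space, (∀ k, ∑ i, n i * ζ k i = 0) ∧ n ≠ 0 := by
    let f : Space →ₗ[ℝ] (Fin 2 → ℝ) :=
      LinearMap.pi fun k => (innerSL ℝ (ζ k)).toLinearMap
    have hf : f.ker ≠ ⊥ := LinearMap.ker_ne_bot_of_finrank_lt (by simp)
    obtain ⟨n, hn, hn0⟩ := Submodule.exists_mem_ne_zero_of_ne_bot hf
    refine ⟨n, fun k => ?_, hn0⟩
    have := congrFun (LinearMap.mem_ker.1 hn) k
    simpa [f, PiLp.inner_apply] using this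
  have hN : 0 < n 0 ^ 2 + n 1 ^ 2 + n 2 ^ 2 := by
    have h1 := norm_pos_iff.2 hn0
    have h2 := EuclideanSpace.real_norm_sq_eq n
    rw [Fin.sum_univ_three] at h2
    rw [← h2]
    positivity
  -- In axial vectors the divergence is minus the curl, so the amplitude A yields -n ∧ A; for n ⊥ ζ
  -- one has -n ∧ (n ∧ ζ) = |n|² ζ.
  refine ⟨innerSL ℝ n, fun k => (n 0 ^ 2 + n 1 ^ 2 + n 2 ^ 2)⁻¹ • wedge n (ζ k), fun h => ?_, ?_⟩
  · have h3 : innerSL ℝ n n = 0 := by rw [h]; simp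
    rw [innerSL_apply_apply, inner_self_eq_zero] at h3
    exact hn0 h3
  · ext k j
    have h4 := hn k
    rw [Fin.sum_univ_three] at h4
    rw [divSkew_apply, Fin.sum_univ_three]
    fin_cases j <;>
      simp [skewEntry_apply, skew, wedge, cross_apply, EuclideanSpace.inner_single_right] <;>
        field_simp
    · linear_combination (-n 0) * h4
    · linear_combination (-n 1) * h4
    · linear_combination (-n 2) * h4

theorem continuous_wedge : Continuous fun ζ : Field => wedge (ζ 0) (ζ 1) := by
  unfold wedge
  refine (PiLp.continuous_toLp 2 _).comp (continuous_pi fun i => ?_)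
  fin_cases i <;> simp [cross_apply] <;> fun_prop

/-- The Born–Infeld manifold is the graph of this map. -/
noncomputable def graphMap (ζ : Field) : Space × ℝ :=
  (wedge (ζ 0) (ζ 1),
    Real.sqrt (1 + ‖ζ 0‖ ^ 2 + ‖ζ 1‖ ^ 2 + ‖wedge (ζ 0) (ζ 1)‖ ^ 2))

theorem continuous_graphMap : Continuous graphMap := by
  have := continuous_wedge
  unfold graphMap
  fun_prop

/-- The splitting of a state into the pair `(D, B)` and the pair `(P, h)`. -/
noncomputable def splitting : State ≃L[ℝ] Field × (Space × ℝ) :=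
  LinearEquiv.toContinuousLinearEquiv
    { toFun := fun M => (![M.D, M.B], (M.P, M.h))
      map_add' := fun M N => by
        ext k j
        · fin_cases k <;> fin_cases j <;> simp [State.D, State.B]
        · fin_cases k <;> simp [State.P]
        · simp [State.h]
      map_smul' := fun c M => by
        ext k j
        · fin_cases k <;> fin_cases j <;> simp [State.D, State.B]
        · fin_cases k <;> simp [State.P]
        · simp [State.h]
      invFun := fun p => !₂[p.1 0 0, p.1 0 1, p.1 0 2, p.1 1 0, p.1 1 1, p.1 1 2,
        p.2.1 0, p.2.1 1, p.2.1 2, p.2.2]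
      left_inv := fun M => by
        ext k
        fin_cases k <;> simp [State.D, State.B, State.P, State.h]
      right_inv := fun p => by
        ext k j
        · fin_cases k <;> fin_cases j <;> simp [State.D, State.B]
        · fin_cases k <;> simp [State.P]
        · simp [State.h] }

theorem splitting_apply (M : State) : splitting M = (![M.D, M.B], (M.P, M.h)) := rfl

theorem mem_manifold_iff (M : State) :
    M ∈ manifold ↔ (splitting M).2 = graphMap (splitting M).1 := by
  simp [manifold, splitting_apply, graphMap, Prod.ext_iff]
  intro h
  rw [h]

theorem rows_apply (M : State) (k : Fin 2) (j : Fin 3) : M.rows k j = (splitting M).1 k j := by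
  fin_cases k <;> simp [State.rows, splitting_apply]

theorem memLp_apply_fderiv {T : Type*} [NormedAddCommGroup T] [NormedSpace ℝ T]
    [FiniteDimensional ℝ T] {C : ℝ≥0} {H : Space → T} (hH : LipschitzWith C H) (c : T →L[ℝ] ℝ)
    (v : Space) (μ : Measure Space) : MemLp (fun x => c (fderiv ℝ H x v)) ∞ μ := by
  have hm := aestronglyMeasurable_comp_fderiv (μ := μ) (𝓛 := ContinuousLinearMap.id ℝ _)
    (q := fun A : Space →L[ℝ] T => c (A v)) (by fun_prop) 0 H
  simp only [zero_add, ContinuousLinearMap.id_apply] at hm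
  refine memLp_top_of_bound hm (‖c‖ * (C * ‖v‖)) (Eventually.of_forall fun x => ?_)
  refine (c.le_opNorm _).trans (mul_le_mul_of_nonneg_left ?_ (norm_nonneg _))
  exact ((fderiv ℝ H x).le_opNorm v).trans
    (mul_le_mul_of_nonneg_right (norm_fderiv_le_of_lipschitz ℝ hH) (norm_nonneg _))

theorem hasWeakPartial_of_lipschitzWith {T : Type*} [NormedAddCommGroup T] [NormedSpace ℝ T]
    [FiniteDimensional ℝ T] {C : ℝ≥0} {H : Space → T} (hH : LipschitzWith C H) (c : T →L[ℝ] ℝ)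
    (Ω : Set Space) (l : Fin 3) : HasWeakPartial Ω l (fun x => c (H x))
      (fun x => c (fderiv ℝ H x (EuclideanSpace.single l 1))) := by
  have hcH : LipschitzWith (‖c‖₊ * C) fun x => c (H x) := c.lipschitz.comp hH
  refine ⟨hcH.continuous.locallyIntegrable.locallyIntegrableOn _,
    ((memLp_apply_fderiv hH c _ volume).locallyIntegrable le_top).locallyIntegrableOn _,
    fun φ hφ hφc hφΩ => ?_⟩
  set e : Space := EuclideanSpace.single l 1
  obtain ⟨D, hD⟩ := hφ.lipschitzWith_of_hasCompactSupport hφc (by simp)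
  have hφ0 (x) (hx : x ∉ Ω) : φ x = 0 := image_eq_zero_of_notMem_tsupport fun h => hx (hφΩ h)
  have hdφ0 (x) (hx : x ∉ Ω) : fderiv ℝ φ x = 0 :=
    image_eq_zero_of_notMem_tsupport fun h => hx (hφΩ (tsupport_fderiv_subset ℝ h))
  have key := LipschitzWith.integral_lineDeriv_mul_eq (μ := volume) hcH hD hφc e
  have h1 : ∫ x, lineDeriv ℝ (fun x => c (H x)) x e * φ x = ∫ x, c (fderiv ℝ H x e) * φ x := by
    refine integral_congr_ae ?_
    filter_upwards [hH.ae_differentiableAt (μ := volume)] with x hx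
    have := (c.hasFDerivAt.comp x hx.hasFDerivAt).hasLineDerivAt e
    rw [HasLineDerivAt.lineDeriv (f := fun x => c (H x)) this]
    rfl
  have h2 (x) : lineDeriv ℝ φ x (-e) = -fderiv ℝ φ x e := by
    rw [((hφ.differentiable (by simp)) x).lineDeriv_eq_fderiv, map_neg]
  rw [h1] at key
  simp only [h2, neg_mul, integral_neg] at key
  -- Both integrands vanish off Ω, so the identity on the whole space restricts to Ω.
  rw [setIntegral_eq_integral_of_forall_compl_eq_zero fun x hx => by simp [hdφ0 x hx],
    setIntegral_eq_integral_of_forall_compl_eq_zero fun x hx => by simp [hφ0 x hx], key, neg_neg]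
  simp only [mul_comm]

/-- Eighteen entries of absolute value at most 1/10 have squares summing to at most 18/100 < 1/4. -/
theorem norm_skew_le {a : Field} {ε : ℝ} (ha : ‖a‖ ≤ ε) (hε : ε ≤ 1 / 10) :
    Tensor.norm (fun k => skew (a k)) ≤ 1 / 2 := by
  refine Real.sqrt_le_iff.2 ⟨by norm_num, ?_⟩
  have h (k : Fin 2) (i j : Fin 3) : skew (a k) i j ^ 2 ≤ 1 / 100 := by
    have h1 := (abs_skew_le (a k) i j).trans ((norm_le_pi_norm a k).trans (ha.trans hε))
    rw [← sq_abs]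
    nlinarith [abs_nonneg (skew (a k) i j)]
  calc ∑ k, ∑ i, ∑ j, skew (a k) i j ^ 2
      ≤ ∑ _k : Fin 2, ∑ _i : Fin 3, ∑ _j : Fin 3, (1 / 100 : ℝ) :=
        Finset.sum_le_sum fun k _ => Finset.sum_le_sum fun i _ =>
          Finset.sum_le_sum fun j _ => h k i j
    _ ≤ (1 / 2) ^ 2 := by norm_num

end BornInfeld

/-! ### The theorem -/

open BornInfeld
theorem theorem4p1 (L : Set State) (hL : IsCompact L)
    (hLM : L ⊆ interior (convexHull ℝ manifold)) :
    ∃ R : ℝ, 0 < R ∧ ∀ Ω : Set Space, IsOpen Ω → Bornology.IsBounded Ω → ∀ F ∈ L,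
      ∃ V : Space → State, MemLp V ∞ (volume.restrict Ω) ∧
        (∃ H : Space → Tensor,
          (∀ k i j, MemW1Inf Ω (fun x => H x k i j)) ∧
          (∀ x ∈ Ω, ∀ k i j, H x k i j = -H x k j i) ∧
          (∃ W : Space → Matrix (Fin 2) (Fin 3) ℝ, IsCalL Ω H W ∧
            ∀ᵐ x ∂volume.restrict Ω, (V x).rows = F.rows + W x) ∧
          eLpNorm (fun x => (H x).norm) ∞ (volume.restrict Ω) < 1 ∧
          (∀ k i j, ContinuousOn (fun x => H x k i j) (closure Ω)) ∧
          (∀ x ∈ frontier Ω, H x = 0)) ∧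
        (∀ᵐ x ∂volume.restrict Ω, V x ∈ manifold) ∧
        eLpNorm V ∞ (volume.restrict Ω) ≤ ENNReal.ofReal R ∧
        ∫ x in Ω, V x = volume.real Ω • F := by
  have himg : splitting '' manifold = {p : Field × (Space × ℝ) | p.2 = graphMap p.1} := by
    ext p
    constructor
    · rintro ⟨M, hM, rfl⟩
      exact (mem_manifold_iff M).1 hM
    · intro hp
      refine ⟨splitting.symm p, (mem_manifold_iff _).2 ?_, splitting.apply_symm_apply p⟩
      rw [splitting.apply_symm_apply]
      exact hp
  have hL' : splitting '' L ⊆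
      interior (convexHull ℝ {p : Field × (Space × ℝ) | p.2 = graphMap p.1}) := by
    have h1 : splitting '' convexHull ℝ manifold = convexHull ℝ (splitting '' manifold) :=
      splitting.toLinearEquiv.toLinearMap.image_convexHull manifold
    have h2 : splitting '' interior (convexHull ℝ manifold) =
        interior (splitting '' convexHull ℝ manifold) :=
      splitting.toHomeomorph.image_interior _
    rw [← himg, ← h1, ← h2]
    exact image_mono hLM
  obtain ⟨R₀, hR₀⟩ := exists_subset_interior_convexHull_graph
    (hL.image splitting.continuous) hL'
  have hcs : Continuous fun ζ : Field => splitting.symm (ζ, graphMap ζ) :=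
    splitting.symm.continuous.comp (continuous_id.prodMk continuous_graphMap)
  obtain ⟨C, hC0, hC⟩ := exists_norm_le_of_norm_lt hcs R₀
  -- C depends only on R₀, hence only on L; adding 1 makes the bound positive.
  refine ⟨C + 1, by linarith, fun Ω hΩ hΩb F hF => ?_⟩
  have hfin : volume Ω ≠ ⊤ := hΩb.measure_lt_top.ne
  set z := (splitting F).1 with hz
  have hy : (splitting F).2 ∈ attainable volume divSkew graphMap R₀ z :=
    mem_attainable_of_mem_interior_convexHull continuous_graphMap exists_divSkew_smulRight_eq
      (hR₀ (mem_image_of_mem _ hF))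
  obtain ⟨H, ⟨CH, hHL⟩, hH0, hHε, hHn, hHi⟩ := exists_isPotentialFor_of_mem_attainable
    continuous_graphMap hy hΩ hfin (by norm_num : (0 : ℝ) < 1 / 10)
  have hbound : ∀ᵐ x ∂volume.restrict Ω, ‖splitting.symm (z + divSkew (fderiv ℝ H x),
      graphMap (z + divSkew (fderiv ℝ H x)))‖ ≤ C := by
    rw [ae_restrict_iff' hΩ.measurableSet]
    filter_upwards [hHn] with x hx hxΩ using hC _ (hx hxΩ)
  have hVm : AEStronglyMeasurable (fun x => splitting.symm (z + divSkew (fderiv ℝ H x),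
      graphMap (z + divSkew (fderiv ℝ H x)))) (volume.restrict Ω) :=
    aestronglyMeasurable_comp_fderiv hcs z H
  refine ⟨fun x => splitting.symm (z + divSkew (fderiv ℝ H x),
      graphMap (z + divSkew (fderiv ℝ H x))), memLp_top_of_bound hVm C hbound,
    ⟨fun x k => skew (H x k), fun k i j => ⟨?_, fun l => ?_⟩, fun x _ k i j => ?_, ?_, ?_,
      fun k i j => ?_, fun x hx => ?_⟩, ?_, ?_, ?_⟩
  · have hc : Continuous fun x => skewEntry k i j (H x) :=
      (skewEntry k i j).continuous.comp hHL.continuous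
    refine memLp_top_of_bound hc.aestronglyMeasurable (1 / 10) (Eventually.of_forall fun x => ?_)
    exact (abs_skew_le (H x k) i j).trans ((norm_le_pi_norm (H x) k).trans (hHε x))
  · exact ⟨_, memLp_apply_fderiv hHL (skewEntry k i j) _ _,
      hasWeakPartial_of_lipschitzWith hHL (skewEntry k i j) Ω l⟩
  · exact skew_apply_comm _ i j
  · refine ⟨fun x => Matrix.of fun k j => divSkew (fderiv ℝ H x) k j,
      ⟨fun l x k => skew (fderiv ℝ H x (EuclideanSpace.single l 1) k), fun l k i j =>
        hasWeakPartial_of_lipschitzWith hHL (skewEntry k i j) Ω l, ?_⟩, ?_⟩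
    · exact Eventually.of_forall fun x k j => divSkew_apply _ k j
    · refine Eventually.of_forall fun x => ?_
      ext k j
      rw [rows_apply, splitting.apply_symm_apply, Matrix.add_apply, rows_apply, ← hz]
      rfl
  · have h1 : eLpNorm (fun x => Tensor.norm fun k => skew (H x k)) ∞ (volume.restrict Ω) ≤
        ENNReal.ofReal (1 / 2) := by
      rw [eLpNorm_exponent_top]
      refine eLpNormEssSup_le_of_ae_bound (Eventually.of_forall fun x => ?_)
      rw [Real.norm_of_nonneg (show 0 ≤ Tensor.norm _ from Real.sqrt_nonneg _)]
      exact norm_skew_le (hHε x) le_rfl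
    refine h1.trans_lt ?_
    rw [← ENNReal.ofReal_one]
    exact (ENNReal.ofReal_lt_ofReal_iff one_pos).2 (by norm_num)
  · exact ((skewEntry k i j).continuous.comp hHL.continuous).continuousOn
  · rw [hΩ.frontier_eq] at hx
    funext k
    simp only [hH0 x hx.2, Pi.zero_apply, skew_zero]
  · refine Eventually.of_forall fun x => (mem_manifold_iff _).2 ?_
    rw [splitting.apply_symm_apply]
  · rw [eLpNorm_exponent_top]
    refine eLpNormEssSup_le_of_ae_bound ?_
    filter_upwards [hbound] with x hx
    linarith
  · have hi1 : IntegrableOn (fun x => z + divSkew (fderiv ℝ H x)) Ω :=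
      integrableOn_comp_fderiv continuous_id hΩ.measurableSet hfin hHn
    have hi2 := integrableOn_comp_fderiv continuous_graphMap hΩ.measurableSet hfin hHn
    have hi3 : IntegrableOn (fderiv ℝ H) Ω := by
      have := integrableOn_comp_fderiv (μ := volume)
        (𝓛 := ContinuousLinearMap.id ℝ (Space →L[ℝ] Field)) (q := id) (R := CH + 1) (z := 0)
        (H := H) continuous_id hΩ.measurableSet hfin (Eventually.of_forall fun x _ => by
          simpa using (norm_fderiv_le_of_lipschitz ℝ hHL (x₀ := x)).trans_lt (lt_add_one _))
      simpa using this
    -- The mean of (P, h) is prescribed by the choice of H; that of (D, B) is z because DH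
    -- integrates to zero.
    have h0 : ∫ x in Ω, fderiv ℝ H x = 0 := by
      rw [setIntegral_eq_integral_of_ae_compl_eq_zero]
      · refine hHL.integral_fderiv_eq_zero (HasCompactSupport.intro hΩb.isCompact_closure ?_)
        exact fun x hx => hH0 x fun h => hx (subset_closure h)
      · filter_upwards [hHL.ae_fderiv_eq_zero_of_eq_zero (μ := volume)] with x hx hxΩ
        exact hx (hH0 x hxΩ)
    have hiz : IntegrableOn (fun _ => z) Ω := integrableOn_const hfin
    have h1 : ∫ x in Ω, (z + divSkew (fderiv ℝ H x)) = volume.real Ω • z := by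
      rw [integral_add hiz (divSkew.integrable_comp hi3),
        divSkew.integral_comp_comm hi3, h0, map_zero, add_zero, setIntegral_const]
    rw [splitting.symm.integral_comp_comm, integral_pair hi1 hi2, h1, hHi, ← Prod.smul_mk,
      map_smul]
    exact congrArg _ (splitting.symm_apply_apply F)
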